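/- Let $d\ge 2$ and let $\Omega\subset\mathbb R^d$ be a bounded polygonal/polyhedral domain (equal to the interior of its closure) with a conforming triangulation $\mathcal T_h$ into finitely many nondegenerate $d$-simplices. Let $\mathcal E_h$ be the set of all $(d-1)$-dimensional faces, $\mathcal E_h^o$ the interior ones (shared by two elements, called $T^+,T^-$ in an arbitrary fixed order), and let the other ones be the boundary faces. Let $\kappa>0$ be constant on each element ($\kappa^\pm=\kappa|_{T^\pm}$), $\alpha>0$, and for $e\in\mathcal E_h^o$ put $$\beta_e=\frac{\kappa^-}{\kappa^++\kappa^-},\qquad \kappa_e=\frac{2\kappa^+\kappa^-}{\kappa^++\kappa^-};$$ for a boundary face $e\subset\partial T$ put $\kappa_e=\kappa|_T$. Let $|e|$ be the $(d-1)$-dimensional measure of $e$, $h_e=|e|$, $m_e$ the mass center of $e$, and $\mathcal P^0_e$ the $L^2(e)$-projection onto constants (the mean value over $e$). With outward unit normals $n^\pm$ of $T^\pm$, set on interior faces $[\![\zeta]\!]=\zeta^+n^++\zeta^-n^-$ and $\{\!\{q\}\!\}_{\delta}=\delta q^++(1-\delta)q^-$; on boundary faces $[\![\zeta]\!]=\zeta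 n$ and $\{\!\{q\}\!\}_\delta=q$. Let $V_h^{DG}$ be the space of discontinuous piecewise affine functions on $\mathcal T_h$. The bilinear form of the IIPG($\beta$)-0 method ($\theta=0$) is $$\mathcal A_0(v,w)=\sum_{T\in\mathcal T_h}\int_T\kappa\nabla v\cdot\nabla w\,dx-\sum_{e\in\mathcal E_h}\int_e\{\!\{\kappa\nabla v\}\!\}_{\beta_e}\cdot[\![w]\!]\,ds+\sum_{e\in\mathcal E_h}\int_e\alpha h_e^{-1}\kappa_e\,\mathcal P^0_e([\![v]\!])\cdot[\![w]\!]\,ds,\qquad v,w\in V_h^{DG}.$$ Let $\mathcal Z_\beta=\{z\in V_h^{DG}:\ \mathcal P^0_e(\{\!\{z\}\!\}_{1-\beta_e})=0\ \ \forall e\in\mathcal E_h^o\}$. For a face $e$ of an element $T$ let $\varphi_{e,T}$ be the affine function on $T$ with $\varphi_{e,T}(m_{e'})=\delta_{e,e'}$ for all faces $e'$ of $T$, extended by zero outside $T$. Put $\psi^z_e=\beta_e\varphi_{e,T^+}-(1-\beta_e)\varphi_{e,T^-}$ for $e\in\mathcal E_h^o$ and $\psi^z_e=\varphi_{e,T}$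 for a boundary face $e\subset\partial T$. Then $\{\psi^z_e\}_{e\in\mathcal E_h}$ is a basis of $\mathcal Z_\beta$, and the matrix $\mathbb A_0^{zz}=\big(\mathcal A_0(\psi^z_{e'},\psi^z_e)\big)_{e,e'\in\mathcal E_h}$ representing, in this basis, the restriction to $\mathcal Z_\beta$ of the operator associated with $\mathcal A_0$ is diagonal, with nonzero diagonal entries $$\mathcal A_0(\psi^z_e,\psi^z_e)=\alpha\,h_e^{-1}\,|e|\,\kappa_e\qquad\forall e\in\mathcal E_h .$$ -/

import Mathlib

open MeasureTheory

noncomputable section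

namespace DG

/-- `ℝᵈ` with the Euclidean norm. -/
abbrev E (d : ℕ) : Type := EuclideanSpace ℝ (Fin d)

/-- The mass center of the simplex with vertex set `s`. -/
def massCenter {d : ℕ} (s : Finset (E d)) : E d := s.centroid ℝ id

/-- A nondegenerate `(d-1)`-simplex has finite `(d-1)`-dimensional measure. -/
theorem measure_face_lt_top {d : ℕ} {e : Finset (E d)} (hc : e.card = d)
    (hi : AffineIndependent ℝ ((↑) : e → E d)) :
    Measure.euclideanHausdorffMeasure (d - 1) (convexHull ℝ (e : Set (E d))) < ⊤ := by
  rcases e.eq_empty_or_nonempty with rfl | ⟨p, hp⟩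
  · simp
  have hfr : Module.finrank ℝ (vectorSpan ℝ (e : Set (E d))) = d - 1 := by
    have h := hi.finrank_vectorSpan (n := d - 1) (by
      have : 0 < e.card := Finset.card_pos.2 ⟨p, hp⟩
      simp; omega)
    rwa [Subtype.range_coe_subtype, Finset.setOfPred_mem] at h
  let W := vectorSpan ℝ (e : Set (E d))
  let f : W → E d := fun w => (w : E d) + p
  have hf : Isometry f := (IsometryEquiv.addRight p).isometry.comp isometry_subtype_coe
  have hcl : Topology.IsClosedEmbedding f := hf.isClosedEmbedding
  have hcomp : IsCompact (convexHull ℝ (e : Set (E d))) := Set.Finite.isCompact_convexHull ℝ e.finite_toSet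
  have himg : f '' (f ⁻¹' convexHull ℝ (e : Set (E d))) = convexHull ℝ (e : Set (E d)) := by
    rw [Set.image_preimage_eq_iff]
    intro x hx
    have hx' : x ∈ affineSpan ℝ (e : Set (E d)) := convexHull_subset_affineSpan _ hx
    have hpa : p ∈ affineSpan ℝ (e : Set (E d)) := mem_affineSpan ℝ (by simpa using hp)
    have := AffineSubspace.vsub_mem_direction hx' hpa
    rw [direction_affineSpan] at this
    exact ⟨⟨x - p, this⟩, by simp [f]⟩
  rw [← himg, hf.euclideanHausdorffMeasure_image, ← hfr]
  exact (hcl.isCompact_preimage hcomp).measure_lt_top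

/-- A conforming triangulation (no hanging nodes) of the bounded polygonal / polyhedral domain `Ω`
into nondegenerate `d`-simplices. A cell is given by the set of its `d + 1` vertices; the closed
simplex is the convex hull of that set. -/
structure Mesh (d : ℕ) (Ω : Set (E d)) where
  cells : Finset (Finset (E d))
  card_eq : ∀ T ∈ cells, T.card = d + 1
  indep : ∀ T ∈ cells, AffineIndependent ℝ ((↑) : T → E d)
  conforming : ∀ T ∈ cells, ∀ T' ∈ cells,
    convexHull ℝ (T : Set (E d)) ∩ convexHull ℝ (T' : Set (E d)) =
      convexHull ℝ ((T : Set (E d)) ∩ (T' : Set (E d)))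
  cover : ⋃ T ∈ cells, convexHull ℝ (T : Set (E d)) = closure Ω
  /-- `Ω` is open and has no slits, so that a face shared by two cells is not on its boundary. -/
  regular : interior (closure Ω) = Ω

namespace Mesh

variable {d : ℕ} {Ω : Set (E d)} (M : Mesh d Ω)

/-- The type of elements of the triangulation. -/
abbrev Cell : Type := {T : Finset (E d) // T ∈ M.cells}

open scoped Classical in
/-- The finite set of all `(d-1)`-dimensional faces (edges if `d = 2`), given by their vertices. -/
def faces : Finset (Finset (E d)) := M.cells.biUnion fun T => T.powersetCard d

/-- The type of all faces (interior and boundary ones). -/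
abbrev Face : Type := {e : Finset (E d) // e ∈ M.faces}

/-- A face is interior if it is shared by two different cells; otherwise it is a boundary face. -/
def IsInterior (e : M.Face) : Prop :=
  ∃ T T' : M.Cell, T ≠ T' ∧ e.1 ⊆ T.1 ∧ e.1 ⊆ T'.1

/-- A choice, for every face `e`, of the names `T⁺` and `T⁻` for the adjacent elements.
For a boundary face both names denote the only element containing `e`. -/
structure Labelling where
  plus : M.Face → M.Cell
  minus : M.Face → M.Cell
  subset_plus : ∀ e, e.1 ⊆ (plus e).1
  subset_minus : ∀ e, e.1 ⊆ (minus e).1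
  plus_ne_minus : ∀ e, M.IsInterior e → plus e ≠ minus e

theorem nonempty_labelling : Nonempty M.Labelling := by
  classical
  have h : ∀ e : M.Face, ∃ p : M.Cell × M.Cell, e.1 ⊆ p.1.1 ∧ e.1 ⊆ p.2.1 ∧
      (M.IsInterior e → p.1 ≠ p.2) := by
    intro e
    by_cases hi : M.IsInterior e
    · obtain ⟨T, T', hne, h1, h2⟩ := hi
      exact ⟨(T, T'), h1, h2, fun _ => hne⟩
    · obtain ⟨T, hT, he⟩ := Finset.mem_biUnion.1 e.2
      have hs := (Finset.mem_powersetCard.1 he).1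
      exact ⟨(⟨T, hT⟩, ⟨T, hT⟩), hs, hs, fun h => absurd h hi⟩
  choose p h1 h2 h3 using h
  exact ⟨⟨fun e => (p e).1, fun e => (p e).2, h1, h2, h3⟩⟩

/-- The closed face as a subset of `ℝᵈ`. -/
def faceSet (e : M.Face) : Set (E d) := convexHull ℝ (e.1 : Set (E d))

/-- The `(d-1)`-dimensional Lebesgue (surface) measure on the face `e`. -/
def surf (e : M.Face) : Measure (E d) :=
  (Measure.euclideanHausdorffMeasure (d - 1)).restrict (M.faceSet e)

/-- `|e|`, the `(d-1)`-dimensional measure of `e`. -/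
def area (e : M.Face) : ℝ := (M.surf e).real Set.univ

/-- The local face size `h_e` in the penalty term: the `(d-1)`-dimensional measure of `e`. -/
def hE (e : M.Face) : ℝ := M.area e

/-- The `L²(e)`-projection onto constants, i.e. the mean value over `e`. -/
def P0 {F : Type*} [NormedAddCommGroup F] [NormedSpace ℝ F] (e : M.Face) (f : E d → F) : F :=
  ⨍ x, f x ∂(M.surf e)

/-- The outward unit normal of the simplex `T` on its face `e`: the normalized component,
orthogonal to `e`, of the vector from the mass center of `T` to the mass center of `e`. -/
def normal (T : M.Cell) (e : M.Face) : E d :=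
  let u := (vectorSpan ℝ (e.1 : Set (E d)))ᗮ.starProjection (massCenter e.1 - massCenter T.1)
  ‖u‖⁻¹ • u

/-- The discontinuous piecewise linear space: one affine function on every cell (no continuity
is imposed, and the trace of `v` on a face of `T` is that of `v T`). -/
abbrev VDG : Type := M.Cell → (E d →ᵃ[ℝ] ℝ)

end Mesh

open scoped Classical in
/-- The canonical local Crouzeix-Raviart function `φ_{e,T}`: the affine function that is `1` at the
mass center of the face `e` of the simplex `T` and `0` at those of the other faces. -/
def crFun {d : ℕ} (T e : Finset (E d)) : E d →ᵃ[ℝ] ℝ :=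
  Classical.epsilon fun φ : E d →ᵃ[ℝ] ℝ =>
    ∀ e' ∈ T.powersetCard d, φ (massCenter e') = if e' = e then 1 else 0

theorem map_massCenter {d : ℕ} {s : Finset (E d)} (hs : s.Nonempty) (φ : E d →ᵃ[ℝ] ℝ) :
    φ (massCenter s) = (s.card : ℝ)⁻¹ * ∑ x ∈ s, φ x := by
  rw [massCenter, Finset.centroid_def, Finset.map_affineCombination _ _ _
    (s.sum_centroidWeights_eq_one_of_nonempty ℝ hs),
    Finset.affineCombination_eq_linear_combination _ _ _
    (s.sum_centroidWeights_eq_one_of_nonempty ℝ hs), Finset.mul_sum]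
  simp

open scoped Classical in
theorem exists_crFun {d : ℕ} (hd : 0 < d) {T e : Finset (E d)} (hT : T.card = d + 1)
    (hi : AffineIndependent ℝ ((↑) : T → E d)) (he : e ∈ T.powersetCard d) :
    ∃ φ : E d →ᵃ[ℝ] ℝ, ∀ e' ∈ T.powersetCard d,
      φ (massCenter e') = if e' = e then 1 else 0 := by
  have hface : ∀ e' ∈ T.powersetCard d, ∃ a ∈ T, e' = T.erase a := by
    intro e' he'
    obtain ⟨hs, hc⟩ := Finset.mem_powersetCard.1 he'
    obtain ⟨a, ha⟩ := Finset.card_eq_one.1 (by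
      rw [Finset.card_sdiff_of_subset hs]; omega : (T \ e').card = 1)
    have haT : a ∈ T := (Finset.mem_sdiff.1 (ha ▸ Finset.mem_singleton_self a : a ∈ T \ e')).1
    refine ⟨a, haT, ?_⟩
    rw [← Finset.sdiff_singleton_eq_erase, ← ha, Finset.sdiff_sdiff_eq_self hs]
  have htop : affineSpan ℝ (Set.range ((↑) : T → E d)) = ⊤ := by
    rw [hi.affineSpan_eq_top_iff_card_eq_finrank_add_one]
    simp [hT]
  let b : AffineBasis T ℝ (E d) := ⟨(↑), hi, htop⟩
  have hb : ∀ i : T, b i = i.1 := fun _ => rfl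
  obtain ⟨a, ha, rfl⟩ := hface e he
  refine ⟨AffineMap.const ℝ (E d) 1 - (d : ℝ) • b.coord ⟨a, ha⟩, ?_⟩
  intro e' he'
  obtain ⟨a', ha', rfl⟩ := hface e' he'
  have hcard : (T.erase a').card = d := (Finset.mem_powersetCard.1 he').2
  have hsum : ∑ x ∈ T.erase a', b.coord ⟨a, ha⟩ x = if a' = a then 0 else 1 := by
    have : ∀ x ∈ T.erase a', b.coord ⟨a, ha⟩ x = if a = x then 1 else 0 := by
      intro x hx
      have := b.coord_apply ⟨a, ha⟩ ⟨x, Finset.mem_of_mem_erase hx⟩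
      rw [hb] at this
      simpa using this
    rw [Finset.sum_congr rfl this]
    by_cases h : a' = a
    · simp [h]
    · simp [h, ha, Ne.symm h]
  have hm := map_massCenter (Finset.card_pos.1 (by omega : 0 < (T.erase a').card))
    (b.coord ⟨a, ha⟩)
  rw [hsum, hcard] at hm
  have hd' : (d : ℝ) ≠ 0 := by positivity
  have hiff : T.erase a' = T.erase a ↔ a' = a := by
    constructor
    · intro h
      by_contra hne
      have : a' ∈ T.erase a := Finset.mem_erase.2 ⟨hne, ha'⟩
      rw [← h] at this
      simp at this
    · rintro rfl; rfl
  simp only [AffineMap.coe_sub, AffineMap.coe_const, AffineMap.coe_smul, Pi.sub_apply,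
    Function.const_apply, Pi.smul_apply, smul_eq_mul, hm, hiff]
  by_cases h : a' = a
  · simp [h]
  · simp [h, hd']

open scoped Classical in
theorem crFun_massCenter {d : ℕ} (hd : 0 < d) {T e : Finset (E d)} (hT : T.card = d + 1)
    (hi : AffineIndependent ℝ ((↑) : T → E d)) (he : e ∈ T.powersetCard d) :
    ∀ e' ∈ T.powersetCard d, crFun T e (massCenter e') = if e' = e then 1 else 0 :=
  Classical.epsilon_spec (exists_crFun hd hT hi he)

theorem affine_ext_massCenter {d : ℕ} (hd : 0 < d) {T : Finset (E d)} (hT : T.card = d + 1)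
    (hi : AffineIndependent ℝ ((↑) : T → E d)) {φ φ' : E d →ᵃ[ℝ] ℝ}
    (h : ∀ e ∈ T.powersetCard d, φ (massCenter e) = φ' (massCenter e)) : φ = φ' := by
  classical
  have hd' : (d : ℝ) ≠ 0 := by positivity
  have htop : affineSpan ℝ (T : Set (E d)) = ⊤ := by
    have := hi.affineSpan_eq_top_iff_card_eq_finrank_add_one.2 (by simp [hT])
    simpa using this
  have key : ∀ a ∈ T, ∑ x ∈ T, (φ x - φ' x) = φ a - φ' a := by
    intro a ha
    have hc : (T.erase a).card = d := by rw [Finset.card_erase_of_mem ha, hT]; rfl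
    have hne := Finset.card_pos.1 (by omega : 0 < (T.erase a).card)
    have := h (T.erase a) (Finset.mem_powersetCard.2 ⟨Finset.erase_subset _ _, hc⟩)
    rw [map_massCenter hne, map_massCenter hne, hc] at this
    have h2 := mul_left_cancel₀ (inv_ne_zero hd') this
    rw [← Finset.add_sum_erase T _ ha, Finset.sum_sub_distrib, h2]
    ring
  have hS : ∑ x ∈ T, (φ x - φ' x) = 0 := by
    have h1 := Finset.sum_congr rfl key
    rw [Finset.sum_const, hT, nsmul_eq_mul] at h1
    push_cast at h1
    have : (d : ℝ) * ∑ x ∈ T, (φ x - φ' x) = 0 := by linarith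
    exact (mul_eq_zero.1 this).resolve_left hd'
  refine AffineMap.ext_on htop fun x hx => ?_
  have := key x (by simpa using hx)
  linarith

namespace Mesh

variable {d : ℕ} {Ω : Set (E d)} (M : Mesh d Ω) (L : M.Labelling)

/-- The weight `β_e = κ⁻ / (κ⁺ + κ⁻)`; `κ T` is the constant value of the coefficient on `T`. -/
def beta (κ : M.Cell → ℝ) (e : M.Face) : ℝ :=
  κ (L.minus e) / (κ (L.plus e) + κ (L.minus e))

open scoped Classical in
/-- The coefficient `κ_e`: the harmonic mean of `κ⁺` and `κ⁻` on an interior face, and the value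
of `κ` on the adjacent cell for a boundary face. -/
def kappaE (κ : M.Cell → ℝ) (e : M.Face) : ℝ :=
  if M.IsInterior e then
    2 * κ (L.plus e) * κ (L.minus e) / (κ (L.plus e) + κ (L.minus e))
  else κ (L.plus e)

open scoped Classical in
/-- The jump `ζ⁺ n⁺ + ζ⁻ n⁻` of `v` on an interior face, and `ζ n` on a boundary face. -/
def jump (v : M.VDG) (e : M.Face) (x : E d) : E d :=
  if M.IsInterior e then
    v (L.plus e) x • M.normal (L.plus e) e + v (L.minus e) x • M.normal (L.minus e) e
  else v (L.plus e) x • M.normal (L.plus e) e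

open scoped Classical in
/-- The weighted average `δ_e q⁺ + (1 - δ_e) q⁻` of an elementwise defined (scalar or vector valued)
function on an interior face, and the one-sided value of `q` on a boundary face. -/
def avg {F : Type*} [AddCommGroup F] [Module ℝ F] (δ : M.Face → ℝ) (q : M.Cell → E d → F)
    (e : M.Face) (x : E d) : F :=
  if M.IsInterior e then δ e • q (L.plus e) x + (1 - δ e) • q (L.minus e) x
  else q (L.plus e) x

/-- The elementwise flux `κ ∇v`. -/
def flux (κ : M.Cell → ℝ) (v : M.VDG) (T : M.Cell) (x : E d) : E d :=
  κ T • gradient (v T) x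

/-- The IP(β)-0 bilinear form `𝒜₀(v, w)` with parameter `θ` and penalty parameter `α`. -/
def A0 (κ : M.Cell → ℝ) (α θ : ℝ) (v w : M.VDG) : ℝ :=
  (∑ T : M.Cell, ∫ x in convexHull ℝ (T.1 : Set (E d)),
      inner ℝ (M.flux κ v T x) (gradient (w T) x))
  - (∑ e : M.Face, ∫ x, inner ℝ (M.avg L (M.beta L κ) (M.flux κ v) e x) (M.jump L w e x)
      ∂(M.surf e))
  + θ * (∑ e : M.Face, ∫ x, inner ℝ (M.jump L v e x) (M.avg L (M.beta L κ) (M.flux κ w) e x)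
      ∂(M.surf e))
  + ∑ e : M.Face, ∫ x, inner ℝ ((α * (M.hE e)⁻¹ * M.kappaE L κ e) • M.P0 e (M.jump L v e))
      (M.jump L w e x) ∂(M.surf e)

/-- `z ∈ 𝒵_β`: the average of `z` with weight `1 - β_e` has mean zero on every interior face. -/
def IsZ (κ : M.Cell → ℝ) (z : M.VDG) : Prop :=
  ∀ e : M.Face, M.IsInterior e →
    M.P0 e (M.avg L (fun e' => 1 - M.beta L κ e') (fun T x => z T x) e) = 0

theorem integrable_surf (e : M.Face) {f : E d → ℝ} (hf : Continuous f) :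
    Integrable f (M.surf e) := by
  obtain ⟨T, hT, he⟩ := Finset.mem_biUnion.1 e.2
  obtain ⟨hs, hc⟩ := Finset.mem_powersetCard.1 he
  have hK : IsCompact (M.faceSet e) := Set.Finite.isCompact_convexHull ℝ e.1.finite_toSet
  have hfin : IsFiniteMeasure (M.surf e) := by
    constructor
    rw [surf, Measure.restrict_apply_univ]
    exact measure_face_lt_top hc ((M.indep T hT).mono (by exact_mod_cast hs))
  obtain ⟨C, hC⟩ := hK.exists_bound_of_continuousOn hf.continuousOn
  exact Integrable.of_bound hf.aestronglyMeasurable C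
    (ae_restrict_of_forall_mem hK.measurableSet hC)

theorem integrable_avg (δ : M.Face → ℝ) (z : M.VDG) (e : M.Face) :
    Integrable (M.avg L δ (fun T x => z T x) e) (M.surf e) := by
  refine M.integrable_surf e ?_
  have h : ∀ T, Continuous (z T) := fun T => (z T).continuous_of_finiteDimensional
  unfold avg
  by_cases hi : M.IsInterior e
  · simp only [hi, if_true]
    exact ((h (L.plus e)).const_smul (δ e)).add ((h (L.minus e)).const_smul (1 - δ e))
  · simp only [hi, if_false]
    exact h _

/-- The space `𝒵_β`. -/
def Zbeta (κ : M.Cell → ℝ) : Submodule ℝ M.VDG where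
  carrier := {z | M.IsZ L κ z}
  zero_mem' := by
    intro e he
    simp [P0, avg]
  add_mem' := by
    intro z w hz hw e he
    have h1 := hz e he
    have h2 := hw e he
    rw [P0, average_eq] at h1 h2 ⊢
    have h : M.avg L (fun e' => 1 - M.beta L κ e') (fun T x => (z + w) T x) e =
        fun x => M.avg L (fun e' => 1 - M.beta L κ e') (fun T x => z T x) e x +
          M.avg L (fun e' => 1 - M.beta L κ e') (fun T x => w T x) e x := by
      funext x
      simp only [avg, he, if_true, Pi.add_apply, AffineMap.coe_add, smul_eq_mul]
      ring
    rw [h, integral_add (M.integrable_avg L _ z e) (M.integrable_avg L _ w e), smul_add, h1, h2,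
      add_zero]
  smul_mem' := by
    intro c z hz e he
    have h1 := hz e he
    rw [P0, average_eq] at h1 ⊢
    have h : M.avg L (fun e' => 1 - M.beta L κ e') (fun T x => (c • z) T x) e =
        fun x => c * M.avg L (fun e' => 1 - M.beta L κ e') (fun T x => z T x) e x := by
      funext x
      simp only [avg, he, if_true, Pi.smul_apply, AffineMap.coe_smul, smul_eq_mul]
      ring
    rw [h, integral_const_mul, smul_eq_mul, mul_left_comm, ← smul_eq_mul (a := (_ : ℝ)⁻¹), h1,
      mul_zero]

open scoped Classical in
/-- The functions `ψ_e^z`: `β_e φ_{e,T⁺}` on `T⁺`, `-(1 - β_e) φ_{e,T⁻}` on `T⁻` and `0` on all other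
cells if `e` is interior; `φ_{e,T}` on the adjacent cell `T` and `0` elsewhere if `e` is a boundary
face. -/
def psi (κ : M.Cell → ℝ) (e : M.Face) : M.VDG := fun T =>
  if M.IsInterior e then
    if T = L.plus e then M.beta L κ e • crFun T.1 e.1
    else if T = L.minus e then -((1 - M.beta L κ e) • crFun T.1 e.1)
    else 0
  else if T = L.plus e then crFun T.1 e.1 else 0

/-- The matrix, in the basis `b` of `𝒵_β`, of the restriction to `𝒵_β` of the operator associated
with `𝒜₀`; columns correspond to the trial and rows to the test function. -/
def matrixZZ (κ : M.Cell → ℝ) (α θ : ℝ) (b : Module.Basis M.Face ℝ (M.Zbeta L κ)) :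
    Matrix M.Face M.Face ℝ :=
  Matrix.of fun e e' => M.A0 L κ α θ (b e' : M.VDG) (b e : M.VDG)

end Mesh

end DG

end

/-! Elementwise integration by parts turns the volume term into face integrals of `{κ∇v}_β · [w]`
plus the jump of the normal flux times the average of `w` with weight `1 - β`. The flux of a
piecewise affine function is piecewise constant, so for `w` in `𝒵_β` the second contribution
vanishes on interior faces, while the first cancels the consistency term. With `θ = 0` only the
penalty survives (`A0_eq_penalty`).

The mean of an affine function over a face is its value at the mass center (`setIntegral_face`), so
the penalty sees only jumps at mass centers. The jump of `ψ_e` is zero at every mass center except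
that of `e`, where it is the unit normal `n⁺`; hence the diagonal matrix. The basis property is also
checked at mass centers: they determine an affine function on each cell, and the constraint on an
interior face leaves one free number there, the jump.

The geometry is derived from barycentric coordinates `λ_a`. Slicing a simplex parallel to a face
gives `|e_a| = d V ‖∇λ_a‖`, the outward normal is `-∇λ_a / ‖∇λ_a‖`, and together they yield the
divergence theorem (`divergence`). Conformity forces opposite normals on a shared face
(`faceNormal_eq_neg`), and hence at most two cells per face. -/

noncomputable section
namespace DG

variable {d : ℕ}

/-! ### Barycentric coordinates of a simplex -/

open scoped Classical in
/-- `lam a`, for `a ∈ T`, are the barycentric coordinate functions of the nondegenerate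
`d`-simplex `T`. -/
structure IsBarycentric (T : Finset (E d)) (lam : E d → (E d →ᵃ[ℝ] ℝ)) : Prop where
  apply_vertex : ∀ a ∈ T, ∀ x ∈ T, lam a x = if x = a then 1 else 0
  map_eq : ∀ (φ : E d →ᵃ[ℝ] ℝ) (z : E d), φ z = ∑ a ∈ T, φ a * lam a z
  sum_smul : ∀ z : E d, ∑ a ∈ T, lam a z • a = z

theorem exists_isBarycentric {T : Finset (E d)} (hT : T.card = d + 1)
    (hi : AffineIndependent ℝ ((↑) : T → E d)) : ∃ lam, IsBarycentric T lam := by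
  classical
  have htop : affineSpan ℝ (Set.range ((↑) : T → E d)) = ⊤ := by
    rw [hi.affineSpan_eq_top_iff_card_eq_finrank_add_one]
    simp [hT]
  let b : AffineBasis T ℝ (E d) := ⟨(↑), hi, htop⟩
  have hb : ∀ i : T, b i = i.1 := fun _ => rfl
  have hcomb : ∀ z, ∑ i : T, b.coord i z • (i : E d) = z := fun z => by
    simpa [hb] using b.linear_combination_coord_eq_self z
  -- Points that are not vertices get the default coordinate `0`, which avoids indexing by the
  -- subtype of vertices.
  refine ⟨fun a => if h : a ∈ T then b.coord ⟨a, h⟩ else 0, ?_, ?_, ?_⟩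
  · intro a ha x hx
    have := b.coord_apply ⟨a, ha⟩ ⟨x, hx⟩
    rw [hb] at this
    simpa [ha, eq_comm] using this
  · intro φ z
    rw [← Finset.sum_coe_sort T]
    have h1 := b.affineCombination_coord_eq_self z
    have h2 := Finset.univ.map_affineCombination b _ (b.sum_coord_apply_eq_one z) φ
    rw [h1, Finset.affineCombination_eq_linear_combination _ _ _ (b.sum_coord_apply_eq_one z)] at h2
    rw [h2]
    refine Finset.sum_congr rfl fun i _ => ?_
    simp [hb, mul_comm]
  · intro z
    rw [← Finset.sum_coe_sort T]
    simpa using hcomb z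

namespace IsBarycentric

variable {T : Finset (E d)} {lam : E d → (E d →ᵃ[ℝ] ℝ)}

theorem sum_eq_one (h : IsBarycentric T lam) (z : E d) : ∑ a ∈ T, lam a z = 1 := by
  simpa using (h.map_eq (AffineMap.const ℝ (E d) 1) z).symm

theorem apply_self (h : IsBarycentric T lam) {a : E d} (ha : a ∈ T) : lam a a = 1 := by
  simp [h.apply_vertex a ha a ha]

theorem apply_ne (h : IsBarycentric T lam) {a x : E d} (ha : a ∈ T) (hx : x ∈ T) (hne : x ≠ a) :
    lam a x = 0 := by
  simp [h.apply_vertex a ha x hx, hne]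

/-- Barycentric description of a face of a simplex. -/
theorem mem_convexHull_iff (h : IsBarycentric T lam) {s : Finset (E d)} (hs : s ⊆ T) {z : E d} :
    z ∈ convexHull ℝ (s : Set (E d)) ↔
      (∀ a ∈ s, 0 ≤ lam a z) ∧ ∀ a ∈ T, a ∉ s → lam a z = 0 := by
  classical
  constructor
  · intro hz
    constructor
    · intro a ha
      have hc : Convex ℝ {y | 0 ≤ lam a y} := (convex_Ici (0 : ℝ)).affine_preimage (lam a)
      refine convexHull_min (fun x hx => ?_) hc hz
      have := h.apply_vertex a (hs ha) x (hs hx)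
      simp only [Set.mem_ofPred_eq, this]
      split_ifs <;> norm_num
    · intro a ha has
      have hc : Convex ℝ {y | lam a y = 0} := (convex_singleton (0 : ℝ)).affine_preimage (lam a)
      refine convexHull_min (fun x hx => ?_) hc hz
      exact h.apply_ne ha (hs hx) (fun e => has (e ▸ hx))
  · rintro ⟨h1, h2⟩
    have e1 : ∑ a ∈ s, lam a z = 1 := by
      rw [← h.sum_eq_one z]
      exact Finset.sum_subset hs fun a ha has => h2 a ha has
    have e2 : ∑ a ∈ s, lam a z • a = z := by
      conv_rhs => rw [← h.sum_smul z]
      exact Finset.sum_subset hs fun a ha has => by rw [h2 a ha has, zero_smul]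
    rw [← e2]
    exact (convex_convexHull ℝ _).sum_mem h1 e1 fun a ha => subset_convexHull ℝ _ ha

end IsBarycentric

/-! ### Gradients of affine functions -/

section Gradient

/-- The constant gradient of an affine function. -/
def grad (φ : E d →ᵃ[ℝ] ℝ) : E d :=
  (InnerProductSpace.toDual ℝ (E d)).symm (LinearMap.toContinuousLinearMap φ.linear)

theorem inner_grad (φ : E d →ᵃ[ℝ] ℝ) (v : E d) : inner ℝ (grad φ) v = φ.linear v := by
  simp [grad]

theorem gradient_affine (φ : E d →ᵃ[ℝ] ℝ) (x : E d) : gradient φ x = grad φ := by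
  rw [gradient, grad]
  congr 1
  have h : HasFDerivAt (fun y => φ y) (LinearMap.toContinuousLinearMap φ.linear) x := by
    have h1 : (fun y => φ y) = fun y => LinearMap.toContinuousLinearMap φ.linear y + φ 0 := by
      funext y
      simpa using congrFun φ.decomp y
    rw [h1]
    exact (LinearMap.toContinuousLinearMap φ.linear).hasFDerivAt.add_const _
  exact h.fderiv

theorem inner_grad_sub (φ : E d →ᵃ[ℝ] ℝ) (x y : E d) : inner ℝ (grad φ) (x - y) = φ x - φ y := by
  rw [inner_grad]
  simpa using φ.linearMap_vsub x y

theorem grad_ne_zero {φ : E d →ᵃ[ℝ] ℝ} {x y : E d} (h : φ x ≠ φ y) : grad φ ≠ 0 := by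
  intro h0
  have := inner_grad_sub φ x y
  rw [h0, inner_zero_left] at this
  exact h (by linarith)

theorem IsBarycentric.grad_eq {T : Finset (E d)} {lam : E d → (E d →ᵃ[ℝ] ℝ)}
    (h : IsBarycentric T lam) (φ : E d →ᵃ[ℝ] ℝ) : grad φ = ∑ a ∈ T, φ a • grad (lam a) := by
  refine ext_inner_right ℝ fun v => ?_
  have := inner_grad_sub φ v 0
  rw [sub_zero, h.map_eq φ v, h.map_eq φ 0] at this
  rw [this, sum_inner, ← Finset.sum_sub_distrib]
  refine Finset.sum_congr rfl fun a _ => ?_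
  have := inner_grad_sub (lam a) v 0
  rw [sub_zero] at this
  rw [real_inner_smul_left, this]
  ring

end Gradient

/-! ### Surface measure on faces and affine symmetries -/

section Measure

open Measure

/-- The `(d-1)`-dimensional measure of the simplex spanned by `e`. -/
def faceArea (e : Finset (E d)) : ℝ :=
  (euclideanHausdorffMeasure (d - 1) : Measure (E d)).real (convexHull ℝ (e : Set (E d)))

theorem isCompact_convexHull_finset (s : Finset (E d)) : IsCompact (convexHull ℝ (s : Set (E d))) :=
  Set.Finite.isCompact_convexHull ℝ s.finite_toSet

/-- An affine involution preserves every Haar measure. -/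
theorem measurePreserving_of_involutive {W : Type*} [NormedAddCommGroup W] [NormedSpace ℝ W]
    [FiniteDimensional ℝ W] [MeasurableSpace W] [BorelSpace W] (μ : Measure W)
    [μ.IsAddHaarMeasure] (A : W →ᵃ[ℝ] W) (hA : Function.Involutive A) :
    MeasurePreserving A μ μ := by
  -- The linear part squares to the identity, so its determinant is `±1` and volumes are not scaled.
  have hL : A.linear ∘ₗ A.linear = LinearMap.id := by
    have : A.comp A = AffineMap.id ℝ W := by ext x; exact hA x
    rw [← AffineMap.comp_linear, this, AffineMap.id_linear]
  have hdet : LinearMap.det A.linear * LinearMap.det A.linear = 1 := by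
    rw [← LinearMap.det_comp, hL, LinearMap.det_id]
  have hne : LinearMap.det A.linear ≠ 0 := fun h => by simp [h] at hdet
  have habs : |(LinearMap.det A.linear)⁻¹| = 1 := by
    rcases mul_self_eq_one_iff.1 hdet with h | h <;> simp [h]
  have h1 : MeasurePreserving A.linear μ μ := by
    refine ⟨A.linear.continuous_of_finiteDimensional.measurable, ?_⟩
    rw [map_linearMap_addHaar_eq_smul_addHaar μ hne, habs]
    simp
  have h2 : (A : W → W) = (fun w => w + A 0) ∘ A.linear := by
    funext w
    rw [AffineMap.decomp' A]
    simp
  rw [h2]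
  exact (measurePreserving_add_right μ (A 0)).comp h1

/-- If an affine involution of `ℝᵈ` preserves a face and its plane, it preserves integrals over
that face. -/
theorem setIntegral_comp_involution {e : Finset (E d)} (hne : e.Nonempty)
    (hfr : Module.finrank ℝ (vectorSpan ℝ (e : Set (E d))) = d - 1) (A : E d →ᵃ[ℝ] E d)
    (hA : Function.Involutive A)
    (hplane : ∀ z, A z - z ∈ vectorSpan ℝ (e : Set (E d)))
    (hface : ∀ z, A z ∈ convexHull ℝ (e : Set (E d)) ↔ z ∈ convexHull ℝ (e : Set (E d)))
    (f : E d → ℝ) :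
    ∫ x in convexHull ℝ (e : Set (E d)), f (A x) ∂(euclideanHausdorffMeasure (d - 1)) =
      ∫ x in convexHull ℝ (e : Set (E d)), f x ∂(euclideanHausdorffMeasure (d - 1)) := by
  obtain ⟨p, hp⟩ := hne
  let W := vectorSpan ℝ (e : Set (E d))
  -- The integral is moved to the direction space `W` of the face: there `d - 1` is the full
  -- dimension, so the Hausdorff measure is a Haar measure and the determinant argument applies.
  let ι : W → E d := fun w => (w : E d) + p
  have hι : Isometry ι := (IsometryEquiv.addRight p).isometry.comp isometry_subtype_coe
  have hcl : Topology.IsClosedEmbedding ι := hι.isClosedEmbedding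
  let S := convexHull ℝ (e : Set (E d))
  have hS : MeasurableSet S := (isCompact_convexHull_finset e).measurableSet
  have hrange : S ⊆ Set.range ι := by
    intro x hx
    have hx' : x ∈ affineSpan ℝ (e : Set (E d)) := convexHull_subset_affineSpan _ hx
    have hpa : p ∈ affineSpan ℝ (e : Set (E d)) := mem_affineSpan ℝ (by simpa using hp)
    have := AffineSubspace.vsub_mem_direction hx' hpa
    rw [direction_affineSpan] at this
    exact ⟨⟨x - p, this⟩, by simp [ι]⟩
  have htrans : ∀ g : E d → ℝ, ∫ x in S, g x ∂(euclideanHausdorffMeasure (d - 1)) =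
      ∫ w in ι ⁻¹' S, g (ι w) ∂(euclideanHausdorffMeasure (d - 1)) := by
    intro g
    rw [← hcl.measurableEmbedding.setIntegral_map, hι.map_euclideanHausdorffMeasure,
      Measure.restrict_restrict hS, Set.inter_eq_left.2 hrange]
  change ∫ x in S, f (A x) ∂_ = ∫ x in S, f x ∂_
  rw [htrans, htrans]
  have hmem : ∀ w : W, A (ι w) - p ∈ W := fun w => by
    have : A (ι w) - p = (A (ι w) - ι w) + w := by
      simp only [ι]
      abel
    rw [this]
    exact W.add_mem (hplane _) w.2
  -- `B` is `A` read in the chart `ι`; it stays in `W` because `A` moves points only parallel to the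
  -- face.
  let B : W →ᵃ[ℝ] W :=
    { toFun := fun w => ⟨A (ι w) - p, hmem w⟩
      linear := LinearMap.codRestrict W (A.linear ∘ₗ W.subtype) (fun w => by
        have h1 := W.sub_mem (hmem w) (hmem 0)
        have : A (ι w) - p - (A (ι 0) - p) = A.linear w := by
          have := A.linearMap_vsub (ι w) (ι 0)
          simp only [vsub_eq_sub] at this
          rw [sub_sub_sub_cancel_right, ← this]
          simp [ι]
        rw [this] at h1
        exact h1)
      map_vadd' := fun w v => by
        apply Subtype.ext
        have := A.map_vadd (ι w) (v : E d)
        simp only [vadd_eq_add] at this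
        change A (((v + w : W) : E d) + p) - p = A.linear v + (A (ι w) - p)
        rw [Submodule.coe_add, add_assoc, ← add_sub_assoc, ← this] }
  have hB : ∀ w, ι (B w) = A (ι w) := fun w => by
    change (A (ι w) - p) + p = _
    simp
  have hinv : Function.Involutive B := fun w => hι.injective (by rw [hB, hB, hA])
  have hmp : MeasurePreserving B (euclideanHausdorffMeasure (d - 1))
      (euclideanHausdorffMeasure (d - 1)) := by
    have : (euclideanHausdorffMeasure (d - 1) : Measure W).IsAddHaarMeasure := by
      rw [← hfr]; infer_instance
    exact measurePreserving_of_involutive _ B hinv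
  have hpre : B ⁻¹' (ι ⁻¹' S) = ι ⁻¹' S := by
    ext w
    simp only [Set.mem_preimage, hB]
    exact hface _
  have hemb : MeasurableEmbedding B :=
    (Homeomorph.mk hinv.toPerm B.continuous_of_finiteDimensional
      B.continuous_of_finiteDimensional).measurableEmbedding
  have := hmp.setIntegral_preimage_emb hemb (fun w => f (ι w)) (ι ⁻¹' S)
  rw [hpre] at this
  simpa only [hB] using this

end Measure

theorem map_add_smul_sub (φ : E d →ᵃ[ℝ] ℝ) (z x y : E d) (c : ℝ) :
    φ (z + c • (y - x)) = φ z + c * (φ y - φ x) := by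
  have h1 := inner_grad_sub φ (z + c • (y - x)) z
  rw [add_sub_cancel_left, real_inner_smul_right, inner_grad_sub] at h1
  linarith

theorem continuous_affine (φ : E d →ᵃ[ℝ] ℝ) : Continuous φ :=
  φ.continuous_of_finiteDimensional

open scoped Classical in
theorem card_erase_vertex {T : Finset (E d)} (hT : T.card = d + 1) {a : E d} (ha : a ∈ T) :
    (T.erase a).card = d := by
  rw [Finset.card_erase_of_mem ha, hT, Nat.add_sub_cancel]

theorem integrableOn_face {e : Finset (E d)} (hc : e.card = d)
    (hi : AffineIndependent ℝ ((↑) : e → E d)) {f : E d → ℝ} (hf : Continuous f) :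
    IntegrableOn f (convexHull ℝ (e : Set (E d))) (Measure.euclideanHausdorffMeasure (d - 1)) := by
  have hK := isCompact_convexHull_finset e
  obtain ⟨C, hC⟩ := hK.exists_bound_of_continuousOn hf.continuousOn
  exact IntegrableOn.of_bound (measure_face_lt_top hc hi) hf.aestronglyMeasurable C
    (ae_restrict_of_forall_mem hK.measurableSet hC)

/-! ### Face integrals and the volume of a simplex -/

namespace IsBarycentric

variable {T : Finset (E d)} {lam : E d → (E d →ᵃ[ℝ] ℝ)}

open scoped Classical in
/-- By symmetry, all barycentric coordinates have the same mean over a face. -/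
theorem setIntegral_lam_eq (h : IsBarycentric T lam) (hT : T.card = d + 1)
    (hi : AffineIndependent ℝ ((↑) : T → E d)) {a : E d} (ha : a ∈ T) {x y : E d}
    (hx : x ∈ T.erase a) (hy : y ∈ T.erase a) :
    ∫ z in convexHull ℝ (T.erase a : Set (E d)), lam x z ∂(Measure.euclideanHausdorffMeasure (d - 1))
      = ∫ z in convexHull ℝ (T.erase a : Set (E d)), lam y z
          ∂(Measure.euclideanHausdorffMeasure (d - 1)) := by
  rcases eq_or_ne x y with rfl | hxy
  · rfl
  set e := T.erase a with he
  have heT : e ⊆ T := Finset.erase_subset _ _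
  have hc : e.card = d := card_erase_vertex hT ha
  have hie : AffineIndependent ℝ ((↑) : e → E d) := hi.mono (by exact_mod_cast heT)
  have hfr : Module.finrank ℝ (vectorSpan ℝ (e : Set (E d))) = d - 1 := by
    have h := hie.finrank_vectorSpan (n := d - 1) (by
      have : 0 < e.card := Finset.card_pos.2 ⟨x, hx⟩
      simp; omega)
    rwa [Subtype.range_coe_subtype, Finset.setOfPred_mem] at h
  -- The map `z ↦ z + g z • (y - x)` swaps the vertices `x`, `y` and fixes the other ones. It
  -- preserves the face and sends `g` to `-g`, so the integral of `g` equals its own negative.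
  let g := lam x - lam y
  have hg : ∀ z, g z = lam x z - lam y z := fun _ => rfl
  let A : E d →ᵃ[ℝ] E d :=
    AffineMap.id ℝ (E d) + (LinearMap.toSpanSingleton ℝ (E d) (y - x)).toAffineMap.comp g
  have hA : ∀ z, A z = z + g z • (y - x) := fun z => by simp [A]
  have xx := h.apply_self (heT hx)
  have yy := h.apply_self (heT hy)
  have xy := h.apply_ne (heT hx) (heT hy) hxy.symm
  have yx := h.apply_ne (heT hy) (heT hx) hxy
  have hgA : ∀ z, g (A z) = -g z := fun z => by
    rw [hA, map_add_smul_sub, hg x, hg y, xx, yy, xy, yx]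
    ring
  have hinv : Function.Involutive A := fun z => by
    rw [hA (A z), hgA, hA z]
    simp
  have hface1 : ∀ z, z ∈ convexHull ℝ (e : Set (E d)) → A z ∈ convexHull ℝ (e : Set (E d)) := by
    intro z hz
    rw [h.mem_convexHull_iff heT] at hz ⊢
    refine ⟨fun b hb => ?_, fun b hb hbe => ?_⟩
    · rw [hA, map_add_smul_sub, hg]
      rcases eq_or_ne b x with rfl | hbx
      · rw [xy, xx]
        linarith [hz.1 y hy]
      rcases eq_or_ne b y with rfl | hby
      · rw [yx, yy]
        linarith [hz.1 x hx]
      rw [h.apply_ne (heT hb) (heT hx) hbx.symm, h.apply_ne (heT hb) (heT hy) hby.symm]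
      linarith [hz.1 b hb]
    · rw [hA, map_add_smul_sub, h.apply_ne hb (heT hx) (fun q => hbe (q ▸ hx)),
        h.apply_ne hb (heT hy) (fun q => hbe (q ▸ hy)), hz.2 b hb hbe]
      ring
  have key := setIntegral_comp_involution ⟨x, hx⟩ hfr A hinv (fun z => by
      rw [hA, add_sub_cancel_left]
      exact Submodule.smul_mem _ _ (vsub_mem_vectorSpan ℝ (by simpa using hy) (by simpa using hx)))
    (fun z => ⟨fun hz => by simpa [hinv z] using hface1 _ hz, hface1 z⟩) g
  simp only [hgA, integral_neg] at key
  have hzero : ∫ z in convexHull ℝ (e : Set (E d)), g z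
      ∂(Measure.euclideanHausdorffMeasure (d - 1)) = 0 := by linarith
  simp only [hg] at hzero
  rw [integral_sub (integrableOn_face hc hie (continuous_affine _))
    (integrableOn_face hc hie (continuous_affine _))] at hzero
  linarith

open scoped Classical in
/-- The mean of an affine function over a face is its value at the mass center. -/
theorem setIntegral_face (h : IsBarycentric T lam) (hd : 0 < d) (hT : T.card = d + 1)
    (hi : AffineIndependent ℝ ((↑) : T → E d)) {a : E d} (ha : a ∈ T) (φ : E d →ᵃ[ℝ] ℝ) :
    ∫ z in convexHull ℝ (T.erase a : Set (E d)), φ z ∂(Measure.euclideanHausdorffMeasure (d - 1))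
      = faceArea (T.erase a) * φ (massCenter (T.erase a)) := by
  set e := T.erase a with he
  have heT : e ⊆ T := Finset.erase_subset _ _
  have hc : e.card = d := card_erase_vertex hT ha
  have hie : AffineIndependent ℝ ((↑) : e → E d) := hi.mono (by exact_mod_cast heT)
  have hne : e.Nonempty := Finset.card_pos.1 (by omega)
  obtain ⟨x, hx⟩ := hne
  have hmeas : MeasurableSet (convexHull ℝ (e : Set (E d))) :=
    (isCompact_convexHull_finset e).measurableSet
  set c := ∫ z in convexHull ℝ (e : Set (E d)), lam x z
    ∂(Measure.euclideanHausdorffMeasure (d - 1)) with hcdef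
  have gen : ∀ ψ : E d →ᵃ[ℝ] ℝ, ∫ z in convexHull ℝ (e : Set (E d)), ψ z
      ∂(Measure.euclideanHausdorffMeasure (d - 1)) = (∑ b ∈ e, ψ b) * c := by
    intro ψ
    have : ∫ z in convexHull ℝ (e : Set (E d)), ψ z ∂(Measure.euclideanHausdorffMeasure (d - 1)) =
        ∫ z in convexHull ℝ (e : Set (E d)), ∑ b ∈ e, ψ b * lam b z
          ∂(Measure.euclideanHausdorffMeasure (d - 1)) := by
      refine setIntegral_congr_fun hmeas fun z hz => ?_
      rw [h.mem_convexHull_iff heT] at hz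
      rw [h.map_eq ψ z, ← Finset.add_sum_erase T _ ha, hz.2 a ha (Finset.notMem_erase _ _)]
      simp [he]
    rw [this, integral_finsetSum _ fun b hb =>
      (integrableOn_face hc hie (continuous_affine _)).const_mul _, Finset.sum_mul]
    refine Finset.sum_congr rfl fun b hb => ?_
    rw [integral_const_mul, hcdef, h.setIntegral_lam_eq hT hi ha hb hx]
  -- The constant function `1` determines the common integral `c` of the coordinates: `|e| = d c`.
  have h1 := gen (AffineMap.const ℝ (E d) 1)
  have hd' : (d : ℝ) ≠ 0 := by positivity
  simp only [AffineMap.const_apply, Finset.sum_const, hc, nsmul_eq_mul, mul_one,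
    setIntegral_const, smul_eq_mul] at h1
  rw [gen, map_massCenter ⟨x, hx⟩, hc, faceArea, h1]
  field_simp

open scoped Classical in
/-- The volume of a simplex in terms of a face and the height over it. -/
theorem volume_eq (h : IsBarycentric T lam) (hd : 0 < d) (hT : T.card = d + 1) {a : E d}
    (ha : a ∈ T) :
    volume.real (convexHull ℝ (T : Set (E d))) =
      ‖grad (lam a)‖⁻¹ * (faceArea (T.erase a) / d) := by
  set e := T.erase a with he
  have heT : e ⊆ T := Finset.erase_subset _ _
  have hc : e.card = d := card_erase_vertex hT ha
  obtain ⟨x, hx⟩ : e.Nonempty := Finset.card_pos.1 (by omega)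
  have hxa : x ≠ a := Finset.ne_of_mem_erase hx
  set G := grad (lam a) with hG
  have hG0 : G ≠ 0 := grad_ne_zero (x := a) (y := x) (by
    rw [h.apply_self ha, h.apply_ne ha (heT hx) hxa]; norm_num)
  have hGn : ‖G‖ ≠ 0 := norm_ne_zero_iff.2 hG0
  -- `v` is the height vector from `a` to the plane of the opposite face: `λ_a` drops from `1` to `1
  -- - s` along `s • v`, so `s` labels the slices parallel to that face.
  let v : E d := -((‖G‖ ^ 2)⁻¹ • G)
  have hv : v ≠ 0 := by simp [v, hG0]
  have hvn : ‖v‖ = ‖G‖⁻¹ := by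
    simp only [v, norm_neg, norm_smul, norm_inv, norm_pow, norm_norm]
    field_simp
  have ht : MeasurableSet (convexHull ℝ (T : Set (E d))) :=
    (isCompact_convexHull_finset T).measurableSet
  have hslice : ∀ (s : ℝ) (y : E d), y ∈ AffineSubspace.mk' (s • v +ᵥ a) (ℝ ∙ v)ᗮ ↔
      lam a y = 1 - s := by
    intro s y
    have h1 : inner ℝ v (y - a) = (‖G‖ ^ 2)⁻¹ * (1 - lam a y) := by
      rw [inner_neg_left, real_inner_smul_left, hG, inner_grad_sub, h.apply_self ha]
      ring
    have h2 : inner ℝ v v = (‖G‖ ^ 2)⁻¹ := by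
      rw [real_inner_self_eq_norm_sq, hvn, inv_pow]
    rw [AffineSubspace.mem_mk', Submodule.mem_orthogonal_singleton_iff_inner_right, vsub_eq_sub,
      vadd_eq_add, sub_add_eq_sub_sub_swap, inner_sub_right, real_inner_smul_right, h1, h2]
    field_simp
    constructor <;> intro h' <;> linarith
  -- For `0 < s ≤ 1` the slice is the image of the face under the homothety with center `a` and
  -- ratio `s`, and has measure `s ^ (d - 1) |e|`. The null set `s = 0` is left out because the
  -- homothety is inverted.
  have hint : ∀ s : ℝ, s ≠ 0 →
      Measure.euclideanHausdorffMeasure (d - 1) (convexHull ℝ (T : Set (E d)) ∩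
        (AffineSubspace.mk' (s • v +ᵥ a) (ℝ ∙ v)ᗮ : Set (E d))) =
      (Set.Ioc (0 : ℝ) 1).indicator (fun s => ENNReal.ofReal (s ^ (d - 1)) *
        Measure.euclideanHausdorffMeasure (d - 1) (convexHull ℝ (e : Set (E d)))) s := by
    intro s hs
    by_cases hs1 : s ∈ Set.Ioc (0 : ℝ) 1
    · rw [Set.indicator_of_mem hs1]
      have hset : convexHull ℝ (T : Set (E d)) ∩
          (AffineSubspace.mk' (s • v +ᵥ a) (ℝ ∙ v)ᗮ : Set (E d)) =
          AffineMap.homothety a s⁻¹ ⁻¹' convexHull ℝ (e : Set (E d)) := by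
        ext y
        have hmap : ∀ b, lam b (AffineMap.homothety a s⁻¹ y) =
            lam b a + s⁻¹ * (lam b y - lam b a) := fun b => by
          rw [AffineMap.homothety_apply, vsub_eq_sub, vadd_eq_add, add_comm, map_add_smul_sub]
        have hmapa : lam a (AffineMap.homothety a s⁻¹ y) = 0 ↔ lam a y = 1 - s := by
          rw [hmap, h.apply_self ha]
          field_simp
          constructor <;> intro h' <;> linarith
        have hmapb : ∀ b ∈ e, (0 ≤ lam b (AffineMap.homothety a s⁻¹ y) ↔ 0 ≤ lam b y) := by
          intro b hb
          rw [hmap, h.apply_ne (heT hb) ha (Finset.ne_of_mem_erase hb).symm, zero_add, sub_zero]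
          exact mul_nonneg_iff_of_pos_left (inv_pos.2 hs1.1)
        rw [Set.mem_inter_iff, SetLike.mem_coe, hslice, Set.mem_preimage,
          h.mem_convexHull_iff subset_rfl, h.mem_convexHull_iff heT]
        constructor
        · rintro ⟨⟨h1, -⟩, h2⟩
          refine ⟨fun b hb => (hmapb b hb).2 (h1 b (heT hb)), fun b hb hbe => ?_⟩
          have : b = a := by
            by_contra hne
            exact hbe (Finset.mem_erase.2 ⟨hne, hb⟩)
          subst this
          exact hmapa.2 h2
        · rintro ⟨h1, h2⟩
          have h3 := hmapa.1 (h2 a ha (Finset.notMem_erase _ _))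
          refine ⟨⟨fun b hb => ?_, fun b hb hb' => absurd hb hb'⟩, h3⟩
          rcases eq_or_ne b a with rfl | hba
          · linarith [hs1.2]
          · have hbe : b ∈ e := Finset.mem_erase.2 ⟨hba, hb⟩
            exact (hmapb b hbe).1 (h1 b hbe)
      rw [hset, euclideanHausdorffMeasure_homothety_preimage _ _ (inv_ne_zero hs),
        ENNReal.smul_def, smul_eq_mul]
      congr 1
      rw [nnnorm_inv, inv_inv, ENNReal.coe_pow, ENNReal.ofReal_pow hs1.1.le]
      congr 1
      rw [ENNReal.ofReal, Real.toNNReal_of_nonneg hs1.1.le]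
      congr 1
      ext
      simp [abs_of_pos hs1.1]
    · rw [Set.indicator_of_notMem hs1]
      convert measure_empty
      · rw [Set.eq_empty_iff_forall_notMem]
        rintro y ⟨hy, hy'⟩
        rw [SetLike.mem_coe, hslice] at hy'
        rw [h.mem_convexHull_iff subset_rfl] at hy
        have h1 := hy.1 a ha
        have h2 : lam a y ≤ 1 := by
          rw [← h.sum_eq_one y]
          exact Finset.single_le_sum (fun b hb => hy.1 b hb) ha
        exact hs1 ⟨lt_of_le_of_ne (by linarith) hs.symm, by linarith⟩
      · infer_instance
  -- Cavalieri's principle along `v`; the factor `1 / d` is the integral of `s ^ (d - 1)` over `[0,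
  -- 1]`.
  have hvol := EuclideanGeometry.euclideanHausdorffMeasure_eq_lintegral a hv ht
  rw [InnerProductSpace.euclideanHausdorffMeasure_eq_volume, finrank_euclideanSpace_fin] at hvol
  have hae : ∀ᵐ s : ℝ, s ≠ 0 := by simp [ae_iff]
  rw [lintegral_congr_ae (hae.mono hint), lintegral_indicator measurableSet_Ioc,
    lintegral_mul_const _ (by fun_prop),
    ← ofReal_integral_eq_lintegral_ofReal
      (by exact ((continuous_pow (d - 1)).integrableOn_Icc).mono_set Set.Ioc_subset_Icc_self)
      (ae_restrict_of_forall_mem measurableSet_Ioc fun s hs => pow_nonneg hs.1.le _),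
    ← intervalIntegral.integral_of_le zero_le_one, integral_pow] at hvol
  rw [Measure.real, hvol, ENNReal.toReal_mul, ENNReal.toReal_mul, toReal_enorm, hvn, faceArea,
    Measure.real, ENNReal.toReal_ofReal (by simp; positivity)]
  have : ((d - 1 : ℕ) : ℝ) + 1 = d := by
    rw [Nat.cast_sub (by omega)]; simp
  rw [this]
  simp only [one_pow, ne_eq, Nat.add_eq_zero_iff, one_ne_zero, and_false, not_false_eq_true, zero_pow,
    sub_zero]
  field_simp

end IsBarycentric

/-! ### Outward normals and the divergence theorem -/

/-- The outward unit normal on the face `e` of the simplex `T`. -/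
def faceNormal (T e : Finset (E d)) : E d :=
  let u := (vectorSpan ℝ (e : Set (E d)))ᗮ.starProjection (massCenter e - massCenter T)
  ‖u‖⁻¹ • u

open scoped Classical in
theorem exists_eq_erase {T e : Finset (E d)} (hT : T.card = d + 1) (heT : e ⊆ T)
    (hc : e.card = d) : ∃ a ∈ T, e = T.erase a := by
  obtain ⟨a, ha⟩ := Finset.card_eq_one.1 (by
    rw [Finset.card_sdiff_of_subset heT]; omega : (T \ e).card = 1)
  refine ⟨a, (Finset.mem_sdiff.1 (ha ▸ Finset.mem_singleton_self a : a ∈ T \ e)).1, ?_⟩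
  rw [← Finset.sdiff_singleton_eq_erase, ← ha, Finset.sdiff_sdiff_eq_self heT]

theorem grad_mem_orthogonal {φ : E d →ᵃ[ℝ] ℝ} {e : Finset (E d)} (h : ∀ x ∈ e, φ x = 0) :
    grad φ ∈ (vectorSpan ℝ (e : Set (E d)))ᗮ := by
  have hle : vectorSpan ℝ (e : Set (E d)) ≤ LinearMap.ker φ.linear := by
    refine Submodule.span_le.2 ?_
    rintro w ⟨x, hx, y, hy, rfl⟩
    have := φ.linearMap_vsub x y
    rw [h x (by simpa using hx), h y (by simpa using hy)] at this
    simpa using this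
  rw [Submodule.mem_orthogonal']
  intro w hw
  rw [inner_grad]
  exact hle hw

namespace IsBarycentric

variable {T : Finset (E d)} {lam : E d → (E d →ᵃ[ℝ] ℝ)}

-- Each of the two points is a combination of the vertices of the face with weights of sum one, so
-- their difference is a combination of the edges `b - x`.
open scoped Classical in
theorem sub_mem_vectorSpan (h : IsBarycentric T lam) {a : E d} (ha : a ∈ T)
    (hne : (T.erase a).Nonempty) {p q : E d} (hp : lam a p = 0) (hq : lam a q = 0) :
    q - p ∈ vectorSpan ℝ ((T.erase a : Finset (E d)) : Set (E d)) := by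
  obtain ⟨x, hx⟩ := hne
  have : q - p = ∑ b ∈ T.erase a, (lam b q - lam b p) • (b - x) := by
    simp only [smul_sub, sub_smul, Finset.sum_sub_distrib, ← Finset.sum_smul]
    have e1 : ∀ z, lam a z = 0 → ∑ b ∈ T.erase a, lam b z • b = z := fun z hz => by
      conv_rhs => rw [← h.sum_smul z, ← Finset.add_sum_erase T _ ha, hz, zero_smul, zero_add]
    have e2 : ∀ z, lam a z = 0 → ∑ b ∈ T.erase a, lam b z = 1 := fun z hz => by
      rw [← h.sum_eq_one z, ← Finset.add_sum_erase T _ ha, hz, zero_add]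
    rw [e1 p hp, e1 q hq, e2 p hp, e2 q hq]
    simp
  rw [this]
  exact Submodule.sum_mem _ fun b hb => Submodule.smul_mem _ _
    (vsub_mem_vectorSpan ℝ (Finset.mem_coe.2 hb) (Finset.mem_coe.2 hx))

theorem grad_lam_ne_zero (h : IsBarycentric T lam) (hd : 0 < d) (hT : T.card = d + 1) {a : E d}
    (ha : a ∈ T) : grad (lam a) ≠ 0 := by
  classical
  obtain ⟨x, hx⟩ : (T.erase a).Nonempty :=
    Finset.card_pos.1 (by rw [card_erase_vertex hT ha]; exact hd)
  refine grad_ne_zero (x := a) (y := x) ?_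
  rw [h.apply_self ha, h.apply_ne ha (Finset.mem_of_mem_erase hx) (Finset.ne_of_mem_erase hx)]
  norm_num

open scoped Classical in
theorem lam_massCenter_erase (h : IsBarycentric T lam) (hd : 0 < d) (hT : T.card = d + 1)
    {a : E d} (ha : a ∈ T) : lam a (massCenter (T.erase a)) = 0 := by
  rw [map_massCenter (Finset.card_pos.1 (by rw [card_erase_vertex hT ha]; exact hd)),
    Finset.sum_eq_zero fun x hx => ?_, mul_zero]
  exact h.apply_ne ha (Finset.mem_of_mem_erase hx) (Finset.ne_of_mem_erase hx)

open scoped Classical in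
/-- The outward normal is the normalized negative gradient of the opposite barycentric
coordinate. -/
theorem faceNormal_eq (h : IsBarycentric T lam) (hd : 0 < d) (hT : T.card = d + 1) {a : E d}
    (ha : a ∈ T) : faceNormal T (T.erase a) = -(‖grad (lam a)‖⁻¹ • grad (lam a)) := by
  have hc := card_erase_vertex hT ha
  have hne : (T.erase a).Nonempty := Finset.card_pos.1 (by omega)
  set G := grad (lam a) with hG
  have hG0 : G ≠ 0 := h.grad_lam_ne_zero hd hT ha
  have hGn : 0 < ‖G‖ := norm_pos_iff.2 hG0
  set p := massCenter (T.erase a)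
  set m := massCenter T
  have hp : lam a p = 0 := h.lam_massCenter_erase hd hT ha
  have hm : lam a m = ((d : ℝ) + 1)⁻¹ := by
    rw [map_massCenter ⟨a, ha⟩, hT, ← Finset.add_sum_erase T _ ha, h.apply_self ha,
      Finset.sum_eq_zero fun x hx =>
        h.apply_ne ha (Finset.mem_of_mem_erase hx) (Finset.ne_of_mem_erase hx)]
    simp
  -- Since `λ_a` is `0` at `p` and `1 / (d + 1)` at `m`, this `c` makes `p - m + c • G` parallel to
  -- the face. The orthogonal component of `p - m` is then `-(c • G)`, and `c > 0` fixes the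
  -- orientation.
  set c : ℝ := ((d : ℝ) + 1)⁻¹ * (‖G‖ ^ 2)⁻¹ with hcdef
  have hcpos : 0 < c := by positivity
  have hq : lam a (p + (p - m + c • G)) = 0 := by
    have h1 := inner_grad_sub (lam a) (p + (p - m + c • G)) p
    rw [add_sub_cancel_left, inner_add_right, real_inner_smul_right, ← hG,
      real_inner_self_eq_norm_sq] at h1
    have h2 := inner_grad_sub (lam a) p m
    rw [← hG] at h2
    rw [h2, hp, hm, hcdef, mul_assoc, inv_mul_cancel₀ (by positivity)] at h1
    linarith
  have hz := h.sub_mem_vectorSpan ha hne hp hq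
  rw [add_sub_cancel_left] at hz
  have hGo : G ∈ (vectorSpan ℝ ((T.erase a : Finset (E d)) : Set (E d)))ᗮ :=
    grad_mem_orthogonal fun x hx =>
      h.apply_ne ha (Finset.mem_of_mem_erase hx) (Finset.ne_of_mem_erase hx)
  have hproj : (vectorSpan ℝ ((T.erase a : Finset (E d)) : Set (E d)))ᗮ.starProjection (p - m) =
      -(c • G) := by
    have h1 : p - m = (p - m + c • G) - c • G := by abel
    rw [h1, map_sub, Submodule.starProjection_eq_self_iff.2 (Submodule.smul_mem _ c hGo),
      (Submodule.starProjection_apply_eq_zero_iff _).2 (Submodule.le_orthogonal_orthogonal _ hz)]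
    simp
  change ‖(vectorSpan ℝ ((T.erase a : Finset (E d)) : Set (E d)))ᗮ.starProjection (p - m)‖⁻¹ •
    (vectorSpan ℝ ((T.erase a : Finset (E d)) : Set (E d)))ᗮ.starProjection (p - m) = _
  rw [hproj, norm_neg, norm_smul, Real.norm_of_nonneg hcpos.le, smul_neg, smul_smul]
  congr 2
  field_simp

-- Multiplied by the normal of `faceNormal_eq`, this gives `|e_a| n_a = -d V ∇λ_a`, in which no norm
-- is left.
open scoped Classical in
theorem faceArea_eq (h : IsBarycentric T lam) (hd : 0 < d) (hT : T.card = d + 1) {a : E d}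
    (ha : a ∈ T) : faceArea (T.erase a) =
      volume.real (convexHull ℝ (T : Set (E d))) * d * ‖grad (lam a)‖ := by
  have h0 := norm_ne_zero_iff.2 (h.grad_lam_ne_zero hd hT ha)
  have hd' : (d : ℝ) ≠ 0 := by positivity
  rw [h.volume_eq hd hT ha]
  field_simp

open scoped Classical in
/-- The divergence theorem on a simplex for a constant vector field times an affine function. -/
theorem divergence (h : IsBarycentric T lam) (hd : 0 < d) (hT : T.card = d + 1) (q : E d)
    (w : E d →ᵃ[ℝ] ℝ) :
    volume.real (convexHull ℝ (T : Set (E d))) * inner ℝ q (grad w) =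
      ∑ a ∈ T, faceArea (T.erase a) * (inner ℝ q (faceNormal T (T.erase a)) *
        w (massCenter (T.erase a))) := by
  set V := volume.real (convexHull ℝ (T : Set (E d)))
  have hd' : (d : ℝ) ≠ 0 := by positivity
  -- Insert `|e_a| n_a = -d V ∇λ_a` and `w(m_a) = (∑ w - w a) / d`. The part with `∑ w` drops out
  -- because `∑ ∇λ_a = 0`; the rest adds up to `V q · ∇w`.
  have hterm : ∀ a ∈ T, faceArea (T.erase a) * (inner ℝ q (faceNormal T (T.erase a)) *
        w (massCenter (T.erase a))) =
      V * (w a * inner ℝ q (grad (lam a))) - V * (∑ b ∈ T, w b) * inner ℝ q (grad (lam a)) := by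
    intro a ha
    have h0 := norm_ne_zero_iff.2 (h.grad_lam_ne_zero hd hT ha)
    have hc := card_erase_vertex hT ha
    rw [h.faceArea_eq hd hT ha, h.faceNormal_eq hd hT ha, inner_neg_right, real_inner_smul_right,
      map_massCenter (Finset.card_pos.1 (by omega)), hc, ← Finset.add_sum_erase T _ ha]
    field_simp
    ring
  rw [Finset.sum_congr rfl hterm, Finset.sum_sub_distrib, ← Finset.mul_sum, ← Finset.mul_sum]
  have hone : ∑ a ∈ T, inner ℝ q (grad (lam a)) = 0 := by
    have h1 := h.grad_eq (AffineMap.const ℝ (E d) 1)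
    have h2 : grad (AffineMap.const ℝ (E d) (1 : ℝ)) = 0 := by simp [grad]
    rw [h2] at h1
    simp only [AffineMap.const_apply, one_smul] at h1
    rw [← inner_sum, ← h1, inner_zero_right]
  rw [hone, h.grad_eq w, inner_sum]
  simp [real_inner_smul_right]

end IsBarycentric

theorem norm_faceNormal (hd : 0 < d) {T e : Finset (E d)} (hT : T.card = d + 1)
    (hi : AffineIndependent ℝ ((↑) : T → E d)) (heT : e ⊆ T) (hc : e.card = d) :
    ‖faceNormal T e‖ = 1 := by
  obtain ⟨lam, h⟩ := exists_isBarycentric hT hi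
  obtain ⟨a, ha, rfl⟩ := exists_eq_erase hT heT hc
  have h0 := norm_ne_zero_iff.2 (h.grad_lam_ne_zero hd hT ha)
  rw [h.faceNormal_eq hd hT ha, norm_neg, norm_smul, norm_inv, norm_norm, inv_mul_cancel₀ h0]

/-- A nondegenerate simplex has nonempty interior, hence positive volume, and `faceArea_eq` passes
this on to its faces. -/
theorem faceArea_pos (hd : 0 < d) {T e : Finset (E d)} (hT : T.card = d + 1)
    (hi : AffineIndependent ℝ ((↑) : T → E d)) (heT : e ⊆ T) (hc : e.card = d) :
    0 < faceArea e := by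
  obtain ⟨lam, h⟩ := exists_isBarycentric hT hi
  obtain ⟨a, ha, rfl⟩ := exists_eq_erase hT heT hc
  have h0 := norm_pos_iff.2 (h.grad_lam_ne_zero hd hT ha)
  have htop : affineSpan ℝ (T : Set (E d)) = ⊤ := by
    have := hi.affineSpan_eq_top_iff_card_eq_finrank_add_one.2 (by simp [hT])
    simpa using this
  have hV : 0 < volume.real (convexHull ℝ (T : Set (E d))) :=
    ENNReal.toReal_pos (Measure.measure_pos_of_nonempty_interior _
      (interior_convexHull_nonempty_iff_affineSpan_eq_top.2 htop)).ne'
      (isCompact_convexHull_finset T).measure_lt_top.ne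
  rw [h.faceArea_eq hd hT ha]
  positivity

/-- Two different simplices that share a face and otherwise do not meet lie on opposite sides
of it. -/
theorem faceNormal_eq_neg (hd : 0 < d) {T T' e : Finset (E d)} (hT : T.card = d + 1)
    (hi : AffineIndependent ℝ ((↑) : T → E d)) (hT' : T'.card = d + 1)
    (hi' : AffineIndependent ℝ ((↑) : T' → E d)) (hne : T ≠ T') (heT : e ⊆ T) (heT' : e ⊆ T')
    (hc : e.card = d)
    (hconf : convexHull ℝ (T : Set (E d)) ∩ convexHull ℝ (T' : Set (E d)) =
      convexHull ℝ ((T : Set (E d)) ∩ (T' : Set (E d)))) :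
    faceNormal T' e = -faceNormal T e := by
  classical
  obtain ⟨lam, h⟩ := exists_isBarycentric hT hi
  obtain ⟨lam', h'⟩ := exists_isBarycentric hT' hi'
  obtain ⟨a, ha, hea⟩ := exists_eq_erase hT heT hc
  obtain ⟨a', ha', hea'⟩ := exists_eq_erase hT' heT' hc
  have hTe : T = insert a e := by rw [hea, Finset.insert_erase ha]
  have hTe' : T' = insert a' e := by rw [hea', Finset.insert_erase ha']
  have haa : a ≠ a' := by
    rintro rfl
    exact hne (hTe.trans hTe'.symm)
  have haT' : a ∉ T' := by
    rw [hTe', Finset.mem_insert]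
    rintro (q | q)
    · exact haa q
    · rw [hea] at q
      exact Finset.notMem_erase _ _ q
  have hinter : (T : Set (E d)) ∩ T' = (e : Set (E d)) := by
    rw [← Finset.coe_inter]
    congr 1
    ext x
    rw [Finset.mem_inter]
    refine ⟨fun hx => ?_, fun hx => ⟨heT hx, heT' hx⟩⟩
    rw [hea, Finset.mem_erase]
    exact ⟨fun q => haT' (q ▸ hx.2), hx.1⟩
  rw [hinter] at hconf
  -- `λ'_{a'}` vanishes on `e`, so it equals `c λ_a`. The sign of `c` tells on which side of the
  -- plane of `e` the vertex `a` lies, as seen from `T'`.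
  set c := lam' a' a with hcdef
  have hexp : ∀ z, lam' a' z = c * lam a z := by
    intro z
    rw [h.map_eq (lam' a') z, ← Finset.add_sum_erase T _ ha, Finset.sum_eq_zero, add_zero]
    intro x hx
    rw [← hea] at hx
    rw [h'.apply_ne ha' (heT' hx) (fun q => ?_), zero_mul]
    rw [hea', q] at hx
    exact Finset.notMem_erase _ _ hx
  have hgrad : grad (lam' a') = c • grad (lam a) := by
    refine ext_inner_right ℝ fun v => ?_
    have h1 := inner_grad_sub (lam' a') v 0
    have h2 := inner_grad_sub (lam a) v 0
    rw [sub_zero] at h1 h2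
    rw [real_inner_smul_left, h1, h2, hexp, hexp]
    ring
  have hG0 := h.grad_lam_ne_zero hd hT ha
  have hc0 : c ≠ 0 := by
    rintro q
    apply h'.grad_lam_ne_zero hd hT' ha'
    rw [hgrad, q, zero_smul]
  have hcneg : c < 0 := by
    -- If `c > 0`, a point slightly off the center of `e` towards `a` lies in both simplices but not
    -- in `e`, against conformity.
    by_contra hcon
    have hcpos : 0 < c := lt_of_le_of_ne (not_lt.1 hcon) hc0.symm
    set p := massCenter e with hpdef
    have hpe : ∀ b ∈ e, lam' b p = (d : ℝ)⁻¹ := by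
      intro b hb
      rw [map_massCenter ⟨b, hb⟩, hc, ← Finset.add_sum_erase e _ hb, h'.apply_self (heT' hb),
        Finset.sum_eq_zero, add_zero, mul_one]
      intro x hx
      exact h'.apply_ne (heT' hb) (heT' (Finset.mem_of_mem_erase hx)) (Finset.ne_of_mem_erase hx)
    have hpe1 : ∀ b ∈ e, lam b p = (d : ℝ)⁻¹ := by
      intro b hb
      rw [map_massCenter ⟨b, hb⟩, hc, ← Finset.add_sum_erase e _ hb, h.apply_self (heT hb),
        Finset.sum_eq_zero, add_zero, mul_one]
      intro x hx
      exact h.apply_ne (heT hb) (heT (Finset.mem_of_mem_erase hx)) (Finset.ne_of_mem_erase hx)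
    have hpa : lam a p = 0 := by
      rw [hpdef, hea]
      exact h.lam_massCenter_erase hd hT ha
    have hdinv : (0 : ℝ) < (d : ℝ)⁻¹ := by positivity
    -- At `t = 0` these coordinates relative to `T'` are all `1 / d`, so they stay positive for
    -- small `t`.
    have hsmall : ∀ᶠ t : ℝ in nhdsWithin 0 (Set.Ioi 0), t < 1 ∧
        ∀ b ∈ e, 0 < (d : ℝ)⁻¹ + t * (lam' b a - (d : ℝ)⁻¹) := by
      apply nhdsWithin_le_nhds
      refine Filter.Eventually.and (eventually_lt_nhds one_pos) ?_
      rw [Filter.eventually_all_finset]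
      intro b _
      have hcont : Continuous fun t : ℝ => (d : ℝ)⁻¹ + t * (lam' b a - (d : ℝ)⁻¹) := by fun_prop
      exact hcont.continuousAt.eventually (lt_mem_nhds (by simpa using hdinv))
    obtain ⟨t, ⟨ht1, htb⟩, ht0⟩ := (hsmall.and self_mem_nhdsWithin).exists
    set y := p + t • (a - p) with hy
    have hya : lam a y = t := by
      rw [hy, map_add_smul_sub, hpa, h.apply_self ha]
      ring
    have hyT : y ∈ convexHull ℝ (T : Set (E d)) := by
      rw [h.mem_convexHull_iff subset_rfl]
      refine ⟨fun b hb => ?_, fun b hb hb' => absurd hb hb'⟩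
      rw [hTe, Finset.mem_insert] at hb
      rcases hb with rfl | hb
      · rw [hya]; exact ht0.le
      · have hba : b ≠ a := by
          rintro rfl
          rw [hea] at hb
          exact Finset.notMem_erase _ _ hb
        rw [hy, map_add_smul_sub, hpe1 b hb, h.apply_ne (heT hb) ha hba.symm]
        nlinarith
    have hyT' : y ∈ convexHull ℝ (T' : Set (E d)) := by
      rw [h'.mem_convexHull_iff subset_rfl]
      refine ⟨fun b hb => ?_, fun b hb hb' => absurd hb hb'⟩
      rw [hTe', Finset.mem_insert] at hb
      rcases hb with rfl | hb
      · rw [hexp, hya]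
        positivity
      · rw [hy, map_add_smul_sub, hpe b hb]
        exact (htb b hb).le
    have hye : y ∈ convexHull ℝ (e : Set (E d)) := hconf ▸ ⟨hyT, hyT'⟩
    rw [h.mem_convexHull_iff heT] at hye
    have := hye.2 a ha (by rw [hea]; exact Finset.notMem_erase _ _)
    linarith
  have n1 := h.faceNormal_eq hd hT ha
  have n2 := h'.faceNormal_eq hd hT' ha'
  rw [← hea] at n1
  rw [← hea'] at n2
  rw [n1, n2, hgrad, norm_smul, Real.norm_of_nonpos hcneg.le, smul_smul, neg_neg, ← neg_smul]
  congr 1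
  have := norm_ne_zero_iff.2 hG0
  field_simp

/-! ### Face integrals, jumps and normals on the mesh -/

namespace Mesh

variable {d : ℕ} {Ω : Set (E d)} (M : Mesh d Ω) (L : M.Labelling)

theorem card_face (e : M.Face) : e.1.card = d := by
  obtain ⟨T, hT, he⟩ := Finset.mem_biUnion.1 e.2
  exact (Finset.mem_powersetCard.1 he).2

theorem area_eq (e : M.Face) : M.area e = faceArea e.1 := by
  rw [area, surf, measureReal_restrict_apply_univ]
  rfl

theorem area_pos (hd : 0 < d) (e : M.Face) : 0 < M.area e := by
  obtain ⟨T, hT, he⟩ := Finset.mem_biUnion.1 e.2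
  obtain ⟨hs, hc⟩ := Finset.mem_powersetCard.1 he
  rw [area_eq]
  exact faceArea_pos hd (M.card_eq T hT) (M.indep T hT) hs hc

theorem integral_surf_affine (hd : 0 < d) (e : M.Face) (φ : E d →ᵃ[ℝ] ℝ) :
    ∫ x, φ x ∂(M.surf e) = M.area e * φ (massCenter e.1) := by
  classical
  obtain ⟨T, hT, he⟩ := Finset.mem_biUnion.1 e.2
  obtain ⟨hs, hc⟩ := Finset.mem_powersetCard.1 he
  obtain ⟨lam, h⟩ := exists_isBarycentric (M.card_eq T hT) (M.indep T hT)
  obtain ⟨a, ha, hea⟩ := exists_eq_erase (M.card_eq T hT) hs hc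
  have := h.setIntegral_face hd (M.card_eq T hT) (M.indep T hT) ha φ
  rw [area_eq, surf, faceSet, hea]
  exact this

theorem integrable_surf_affine (e : M.Face) (φ : E d →ᵃ[ℝ] ℝ) : Integrable φ (M.surf e) :=
  M.integrable_surf e (continuous_affine φ)

theorem integrable_jump (v : M.VDG) (e : M.Face) : Integrable (M.jump L v e) (M.surf e) := by
  unfold jump
  split_ifs
  · exact ((M.integrable_surf_affine e _).smul_const _).add
      ((M.integrable_surf_affine e _).smul_const _)
  · exact (M.integrable_surf_affine e _).smul_const _

/-- The normals are fixed vectors and the traces are affine, so evaluation at the mass center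
integrates the jump exactly. -/
theorem integral_jump (hd : 0 < d) (v : M.VDG) (e : M.Face) :
    ∫ x, M.jump L v e x ∂(M.surf e) = M.area e • M.jump L v e (massCenter e.1) := by
  unfold jump
  split_ifs
  · rw [integral_add ((M.integrable_surf_affine e _).smul_const _)
      ((M.integrable_surf_affine e _).smul_const _), integral_smul_const, integral_smul_const,
      M.integral_surf_affine hd, M.integral_surf_affine hd, smul_add, smul_smul, smul_smul]
  · rw [integral_smul_const, M.integral_surf_affine hd, smul_smul]

theorem P0_jump (hd : 0 < d) (v : M.VDG) (e : M.Face) :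
    M.P0 e (M.jump L v e) = M.jump L v e (massCenter e.1) := by
  rw [P0, average_eq, M.integral_jump L hd]
  exact inv_smul_smul₀ (M.area_pos hd e).ne' _

theorem integral_inner_jump (hd : 0 < d) (w : M.VDG) (e : M.Face) (c : E d) :
    ∫ x, inner ℝ c (M.jump L w e x) ∂(M.surf e) =
      M.area e * inner ℝ c (M.jump L w e (massCenter e.1)) := by
  rw [integral_inner (M.integrable_jump L w e), M.integral_jump L hd, real_inner_smul_right]

/-- Membership in `𝒵_β` becomes one pointwise equation per interior face; the weight on `T⁻` is `1 -
(1 - β) = β`. -/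
theorem isZ_iff (hd : 0 < d) (κ : M.Cell → ℝ) (z : M.VDG) :
    M.IsZ L κ z ↔ ∀ e : M.Face, M.IsInterior e →
      (1 - M.beta L κ e) * z (L.plus e) (massCenter e.1) +
        M.beta L κ e * z (L.minus e) (massCenter e.1) = 0 := by
  refine forall₂_congr fun e he => ?_
  have h : ∫ x, M.avg L (fun e' => 1 - M.beta L κ e') (fun T x => z T x) e x ∂(M.surf e) =
      M.area e * ((1 - M.beta L κ e) * z (L.plus e) (massCenter e.1) +
        M.beta L κ e * z (L.minus e) (massCenter e.1)) := by
    simp only [avg, he, if_true, smul_eq_mul, sub_sub_cancel]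
    rw [integral_add ((M.integrable_surf_affine e _).const_mul _)
      ((M.integrable_surf_affine e _).const_mul _), integral_const_mul, integral_const_mul,
      M.integral_surf_affine hd, M.integral_surf_affine hd]
    ring
  have ha := (M.area_pos hd e).ne'
  rw [P0, average_eq, h]
  change (M.area e)⁻¹ • _ = 0 ↔ _
  rw [smul_eq_mul, inv_mul_cancel_left₀ ha]

theorem normal_eq_neg (hd : 0 < d) {T T' : M.Cell} (hne : T ≠ T') {e : M.Face} (h : e.1 ⊆ T.1)
    (h' : e.1 ⊆ T'.1) : M.normal T' e = -M.normal T e :=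
  faceNormal_eq_neg hd (M.card_eq _ T.2) (M.indep _ T.2) (M.card_eq _ T'.2) (M.indep _ T'.2)
    (fun q => hne (Subtype.ext q)) h h' (M.card_face e) (M.conforming _ T.2 _ T'.2)

theorem norm_normal (hd : 0 < d) {T : M.Cell} {e : M.Face} (h : e.1 ⊆ T.1) :
    ‖M.normal T e‖ = 1 :=
  norm_faceNormal hd (M.card_eq _ T.2) (M.indep _ T.2) h (M.card_face e)

theorem normal_minus (hd : 0 < d) {e : M.Face} (he : M.IsInterior e) :
    M.normal (L.minus e) e = -M.normal (L.plus e) e :=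
  M.normal_eq_neg hd (L.plus_ne_minus e he) (L.subset_plus e) (L.subset_minus e)

/-- No face belongs to more than two cells. -/
theorem eq_plus_or_minus (hd : 0 < d) {e : M.Face} (he : M.IsInterior e) {T : M.Cell}
    (hT : e.1 ⊆ T.1) : T = L.plus e ∨ T = L.minus e := by
  by_contra! hcon
  -- The normal of a third cell would be opposite to both `n⁺` and `n⁻ = -n⁺`, hence zero.
  have h1 := M.normal_eq_neg hd hcon.1 hT (L.subset_plus e)
  have h2 := M.normal_eq_neg hd hcon.2 hT (L.subset_minus e)
  rw [M.normal_minus L hd he, h1, neg_neg] at h2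
  have h3 := M.norm_normal hd hT
  have h4 : M.normal T e = 0 := by
    rwa [eq_neg_iff_add_eq_zero, ← two_smul ℝ, smul_eq_zero_iff_right two_ne_zero] at h2
  rw [h4, norm_zero] at h3
  exact zero_ne_one h3

theorem eq_plus {e : M.Face} (he : ¬ M.IsInterior e) {T : M.Cell} (hT : e.1 ⊆ T.1) :
    T = L.plus e := by
  by_contra hne
  exact he ⟨T, L.plus e, hne, hT, L.subset_plus e⟩

/-! ### Integration by parts and reduction to the penalty term -/

open scoped Classical in
theorem sum_cells_faces (hd : 0 < d) (f : M.Cell → M.Face → ℝ) :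
    ∑ T : M.Cell, ∑ e : M.Face, (if e.1 ⊆ T.1 then f T e else 0) =
      ∑ e : M.Face, if M.IsInterior e then f (L.plus e) e + f (L.minus e) e else f (L.plus e) e := by
  rw [Finset.sum_comm]
  refine Finset.sum_congr rfl fun e _ => ?_
  split_ifs with he
  · rw [← Finset.sum_pair (L.plus_ne_minus e he) (f := fun T => f T e)]
    symm
    refine Finset.sum_subset_zero_on_sdiff (Finset.subset_univ _) (fun T hT => ?_) fun T hT => ?_
    · simp only [Finset.mem_sdiff, Finset.mem_univ, true_and, Finset.mem_insert,
        Finset.mem_singleton] at hT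
      exact if_neg fun q => hT (M.eq_plus_or_minus L hd he q)
    · rw [Finset.mem_insert, Finset.mem_singleton] at hT
      rcases hT with rfl | rfl
      · rw [if_pos (L.subset_plus e)]
      · rw [if_pos (L.subset_minus e)]
  · rw [Finset.sum_eq_single (L.plus e), if_pos (L.subset_plus e)]
    · exact fun T _ hT => if_neg fun q => hT (M.eq_plus L he q)
    · exact fun q => absurd (Finset.mem_univ _) q

-- The bijection `a ↦ T.erase a` between vertices and opposite faces lets `divergence` be used with
-- mesh faces.
open scoped Classical in
theorem sum_faces_cell (T : M.Cell) (g : Finset (E d) → ℝ) :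
    ∑ e : M.Face, (if e.1 ⊆ T.1 then g e.1 else 0) = ∑ a ∈ T.1, g (T.1.erase a) := by
  have hT := M.card_eq _ T.2
  rw [← Finset.sum_filter]
  symm
  refine Finset.sum_bij (fun a ha => (⟨T.1.erase a, Finset.mem_biUnion.2 ⟨T.1, T.2,
    Finset.mem_powersetCard.2 ⟨Finset.erase_subset _ _, card_erase_vertex hT ha⟩⟩⟩ : M.Face))
    (fun a ha => ?_) (fun a ha b hb hab => ?_) (fun e he => ?_) (fun a ha => rfl)
  · rw [Finset.mem_filter]
    exact ⟨Finset.mem_univ _, Finset.erase_subset _ _⟩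
  · exact (Finset.erase_inj _ ha).1 (congrArg Subtype.val hab)
  · rw [Finset.mem_filter] at he
    obtain ⟨a, ha, hea⟩ := exists_eq_erase hT he.2 (M.card_face e)
    exact ⟨a, ha, Subtype.ext hea.symm⟩

-- Both gradients are constant on the cell, so this is `divergence` with `q = κ ∇v`.
open scoped Classical in
theorem integral_cell (hd : 0 < d) (κ : M.Cell → ℝ) (v w : M.VDG) (T : M.Cell) :
    ∫ x in convexHull ℝ (T.1 : Set (E d)), inner ℝ (M.flux κ v T x) (gradient (w T) x) =
      ∑ e : M.Face, if e.1 ⊆ T.1 then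
        M.area e * (inner ℝ (κ T • grad (v T)) (M.normal T e) * w T (massCenter e.1)) else 0 := by
  obtain ⟨lam, h⟩ := exists_isBarycentric (M.card_eq _ T.2) (M.indep _ T.2)
  simp only [flux, gradient_affine, setIntegral_const, smul_eq_mul]
  rw [h.divergence hd (M.card_eq _ T.2), ← M.sum_faces_cell T fun e =>
    faceArea e * (inner ℝ (κ T • grad (v T)) (faceNormal T.1 e) * w T (massCenter e))]
  refine Finset.sum_congr rfl fun e _ => ?_
  rw [area_eq]
  rfl

/-- On test functions in `𝒵_β` only the penalty term of the form with `θ = 0` remains. -/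
theorem A0_eq_penalty (hd : 0 < d) (κ : M.Cell → ℝ) (α : ℝ) (v w : M.VDG) (hw : M.IsZ L κ w) :
    M.A0 L κ α 0 v w = ∑ e : M.Face, α * (M.hE e)⁻¹ * M.kappaE L κ e * M.area e *
      inner ℝ (M.jump L v e (massCenter e.1)) (M.jump L w e (massCenter e.1)) := by
  rw [isZ_iff M L hd] at hw
  have hcons : ∑ T : M.Cell, ∫ x in convexHull ℝ (T.1 : Set (E d)),
        inner ℝ (M.flux κ v T x) (gradient (w T) x) =
      ∑ e : M.Face, ∫ x, inner ℝ (M.avg L (M.beta L κ) (M.flux κ v) e x) (M.jump L w e x)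
        ∂(M.surf e) := by
    simp only [M.integral_cell hd]
    rw [M.sum_cells_faces L hd fun T e =>
      M.area e * (inner ℝ (κ T • grad (v T)) (M.normal T e) * w T (massCenter e.1))]
    refine Finset.sum_congr rfl fun e _ => ?_
    simp only [avg, flux, gradient_affine]
    split_ifs with he
    · rw [M.integral_inner_jump L hd]
      simp only [jump, he, if_true]
      rw [M.normal_minus L hd he]
      simp only [inner_add_left, inner_add_right, real_inner_smul_left, real_inner_smul_right,
        inner_neg_right]
      -- The difference of the two sides is the jump of the normal flux times the `(1 - β)`-weighted
      -- average of `w` at the mass center, which is zero by `hw`.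
      linear_combination (M.area e * (κ (L.plus e) * inner ℝ (grad (v (L.plus e)))
        (M.normal (L.plus e) e) - κ (L.minus e) * inner ℝ (grad (v (L.minus e)))
        (M.normal (L.plus e) e))) * hw e he
    · rw [M.integral_inner_jump L hd]
      simp only [jump, he, if_false]
      rw [real_inner_smul_right]
      ring
  rw [A0, hcons]
  simp only [sub_self, zero_mul, zero_add]
  refine Finset.sum_congr rfl fun e _ => ?_
  rw [M.integral_inner_jump L hd, M.P0_jump L hd, real_inner_smul_left]
  ring

/-! ### Values and jumps of the functions `ψ_e`, and the matrix entries -/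

theorem mem_powersetCard {T : M.Cell} {e : M.Face} (h : e.1 ⊆ T.1) :
    e.1 ∈ T.1.powersetCard d :=
  Finset.mem_powersetCard.2 ⟨h, M.card_face e⟩

open scoped Classical in
theorem crFun_apply_massCenter (hd : 0 < d) {T : M.Cell} {e e' : M.Face} (h : e.1 ⊆ T.1)
    (h' : e'.1 ⊆ T.1) : crFun T.1 e.1 (massCenter e'.1) = if e' = e then 1 else 0 := by
  rw [crFun_massCenter hd (M.card_eq _ T.2) (M.indep _ T.2) (M.mem_powersetCard h) e'.1
    (M.mem_powersetCard h')]
  simp only [Subtype.ext_iff]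

/-- `ψ_e^z` vanishes at the mass centers of all faces but `e`. -/
theorem psi_apply_of_ne (hd : 0 < d) (κ : M.Cell → ℝ) {e e' : M.Face} (hne : e' ≠ e) {T : M.Cell}
    (h' : e'.1 ⊆ T.1) : M.psi L κ e T (massCenter e'.1) = 0 := by
  unfold psi
  split_ifs with h1 h2 h3 h4
  · subst h2
    simp [M.crFun_apply_massCenter hd (L.subset_plus e) h', hne]
  · subst h3
    simp [M.crFun_apply_massCenter hd (L.subset_minus e) h', hne]
  · rfl
  · subst h4
    simp [M.crFun_apply_massCenter hd (L.subset_plus e) h', hne]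
  · rfl

theorem psi_plus (hd : 0 < d) (κ : M.Cell → ℝ) {e : M.Face} (he : M.IsInterior e) :
    M.psi L κ e (L.plus e) (massCenter e.1) = M.beta L κ e := by
  simp [psi, he, M.crFun_apply_massCenter hd (L.subset_plus e) (L.subset_plus e)]

theorem psi_minus (hd : 0 < d) (κ : M.Cell → ℝ) {e : M.Face} (he : M.IsInterior e) :
    M.psi L κ e (L.minus e) (massCenter e.1) = -(1 - M.beta L κ e) := by
  simp [psi, he, (L.plus_ne_minus e he).symm,
    M.crFun_apply_massCenter hd (L.subset_minus e) (L.subset_minus e)]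

theorem psi_boundary (hd : 0 < d) (κ : M.Cell → ℝ) {e : M.Face} (he : ¬ M.IsInterior e) :
    M.psi L κ e (L.plus e) (massCenter e.1) = 1 := by
  simp [psi, he, M.crFun_apply_massCenter hd (L.subset_plus e) (L.subset_plus e)]

theorem psi_isZ (hd : 0 < d) (κ : M.Cell → ℝ) (e : M.Face) : M.IsZ L κ (M.psi L κ e) := by
  rw [isZ_iff M L hd]
  intro e' he'
  rcases eq_or_ne e' e with rfl | hne
  · rw [M.psi_plus L hd κ he', M.psi_minus L hd κ he']
    ring
  · rw [M.psi_apply_of_ne L hd κ hne (L.subset_plus e'),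
      M.psi_apply_of_ne L hd κ hne (L.subset_minus e')]
    ring

theorem jump_psi_of_ne (hd : 0 < d) (κ : M.Cell → ℝ) {e e' : M.Face} (hne : e' ≠ e) :
    M.jump L (M.psi L κ e) e' (massCenter e'.1) = 0 := by
  unfold jump
  rw [M.psi_apply_of_ne L hd κ hne (L.subset_plus e'),
    M.psi_apply_of_ne L hd κ hne (L.subset_minus e')]
  simp

/-- On an interior face the traces `β` and `-(1 - β)` differ by exactly `1`, so the jump does not
depend on `κ`. -/
theorem jump_psi_self (hd : 0 < d) (κ : M.Cell → ℝ) (e : M.Face) :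
    M.jump L (M.psi L κ e) e (massCenter e.1) = M.normal (L.plus e) e := by
  unfold jump
  split_ifs with he
  · rw [M.psi_plus L hd κ he, M.psi_minus L hd κ he, M.normal_minus L hd he, smul_neg, neg_smul,
      neg_neg, ← add_smul, add_sub_cancel, one_smul]
  · rw [M.psi_boundary L hd κ he, one_smul]

-- The jump of the test function leaves only the face `e` in the penalty sum; there the jump of the
-- trial function is zero unless `e' = e`.
open scoped Classical in
theorem A0_psi (hd : 0 < d) (κ : M.Cell → ℝ) (α : ℝ) (e e' : M.Face) :
    M.A0 L κ α 0 (M.psi L κ e') (M.psi L κ e) =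
      if e = e' then α * (M.hE e)⁻¹ * M.area e * M.kappaE L κ e else 0 := by
  rw [M.A0_eq_penalty L hd κ α _ _ (M.psi_isZ L hd κ e), Finset.sum_eq_single e]
  · split_ifs with h
    · subst h
      rw [M.jump_psi_self L hd, real_inner_self_eq_norm_sq, M.norm_normal hd (L.subset_plus e)]
      ring
    · rw [M.jump_psi_of_ne L hd κ h, inner_zero_left, mul_zero]
  · intro e'' _ hne
    rw [M.jump_psi_of_ne L hd κ hne, inner_zero_right, mul_zero]
  · exact fun q => absurd (Finset.mem_univ _) q

/-! ### The basis of `𝒵_β` -/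

open scoped Classical in
/-- The degree of freedom dual to `ψ_e^z`. -/
def coeff (z : M.VDG) (e : M.Face) : ℝ :=
  if M.IsInterior e then z (L.plus e) (massCenter e.1) - z (L.minus e) (massCenter e.1)
  else z (L.plus e) (massCenter e.1)

open scoped Classical in
theorem coeff_psi (hd : 0 < d) (κ : M.Cell → ℝ) (e e' : M.Face) :
    M.coeff L (M.psi L κ e) e' = if e' = e then 1 else 0 := by
  unfold coeff
  rcases eq_or_ne e' e with rfl | hne
  · rw [if_pos rfl]
    split_ifs with he
    · rw [M.psi_plus L hd κ he, M.psi_minus L hd κ he]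
      ring
    · exact M.psi_boundary L hd κ he
  · rw [M.psi_apply_of_ne L hd κ hne (L.subset_plus e'),
      M.psi_apply_of_ne L hd κ hne (L.subset_minus e')]
    simp [hne]

/-- The coefficients of an element of the discontinuous space as a linear map. -/
def coeffₗ : M.VDG →ₗ[ℝ] (M.Face → ℝ) where
  toFun z := M.coeff L z
  map_add' z w := by
    funext e
    simp only [coeff, Pi.add_apply, AffineMap.coe_add]
    split_ifs <;> ring
  map_smul' c z := by
    funext e
    simp only [coeff, Pi.smul_apply, AffineMap.coe_smul, smul_eq_mul, RingHom.id_apply]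
    split_ifs <;> ring

theorem sum_coeff_apply (κ : M.Cell → ℝ) (c : M.Face → ℝ) (T : M.Cell) (x : E d) :
    (∑ e, c e • M.psi L κ e : M.VDG) T x = ∑ e, c e * M.psi L κ e T x := by
  rw [Finset.sum_apply]
  have : ∀ s : Finset M.Face, (∑ e ∈ s, (c e • M.psi L κ e) T) x =
      ∑ e ∈ s, c e * M.psi L κ e T x := by
    classical
    intro s
    induction s using Finset.induction_on with
    | empty => simp
    | insert a s ha ih =>
      rw [Finset.sum_insert ha, Finset.sum_insert ha, AffineMap.coe_add, Pi.add_apply, ih]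
      rfl
  exact this _

/-- It suffices to compare values at mass centers. On an interior face, `(1 - β) z⁺ + β z⁻ = 0`
gives `z⁺ = β (z⁺ - z⁻)` and `z⁻ = -(1 - β) (z⁺ - z⁻)`, which are the values of the expansion. -/
theorem sum_coeff_smul_psi (hd : 0 < d) (κ : M.Cell → ℝ) {z : M.VDG} (hz : M.IsZ L κ z) :
    ∑ e, M.coeff L z e • M.psi L κ e = z := by
  classical
  rw [isZ_iff M L hd] at hz
  funext T
  refine affine_ext_massCenter hd (M.card_eq _ T.2) (M.indep _ T.2) fun s hs => ?_
  obtain ⟨e, rfl⟩ : ∃ e : M.Face, e.1 = s := ⟨⟨s, Finset.mem_biUnion.2 ⟨T.1, T.2, hs⟩⟩, rfl⟩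
  have heT : e.1 ⊆ T.1 := (Finset.mem_powersetCard.1 hs).1
  rw [sum_coeff_apply, Finset.sum_eq_single e]
  · by_cases he : M.IsInterior e
    · have := hz e he
      rcases M.eq_plus_or_minus L hd he heT with rfl | rfl
      · rw [M.psi_plus L hd κ he, coeff, if_pos he]
        linarith
      · rw [M.psi_minus L hd κ he, coeff, if_pos he]
        linarith
    · obtain rfl := M.eq_plus L he heT
      rw [M.psi_boundary L hd κ he, coeff, if_neg he, mul_one]
  · intro e' _ hne
    rw [M.psi_apply_of_ne L hd κ hne.symm heT, mul_zero]
  · exact fun q => absurd (Finset.mem_univ _) q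

/-- The functions `ψ_e^z` form a basis of `𝒵_β`. -/
def psiBasis (hd : 0 < d) (κ : M.Cell → ℝ) : Module.Basis M.Face ℝ (M.Zbeta L κ) :=
  -- Coefficients and linear combination are mutually inverse: `coeff_psi` gives independence,
  -- `sum_coeff_smul_psi` gives spanning.
  Module.Basis.ofEquivFun <| LinearEquiv.ofLinearMap (M.coeffₗ L ∘ₗ (M.Zbeta L κ).subtype)
    (Fintype.linearCombination ℝ fun e => (⟨M.psi L κ e, M.psi_isZ L hd κ e⟩ : M.Zbeta L κ))
    (by
      classical
      ext e e'
      simp [Fintype.linearCombination_apply, Pi.single_apply, coeffₗ, M.coeff_psi L hd])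
    (by
      ext1 z
      apply Subtype.ext
      simpa [Fintype.linearCombination_apply, coeffₗ] using M.sum_coeff_smul_psi L hd κ z.2)

theorem psiBasis_apply (hd : 0 < d) (κ : M.Cell → ℝ) (e : M.Face) :
    (M.psiBasis L hd κ e : M.VDG) = M.psi L κ e := by
  classical
  simp [psiBasis, Fintype.linearCombination_apply, Pi.single_apply]

theorem kappaE_pos {κ : M.Cell → ℝ} (hκ : ∀ T, 0 < κ T) (e : M.Face) : 0 < M.kappaE L κ e := by
  have h1 := hκ (L.plus e)
  have h2 := hκ (L.minus e)
  unfold kappaE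
  split_ifs <;> positivity

end Mesh

end DG
end

theorem lemma4p3 {d : ℕ} (hd : 2 ≤ d) {Ω : Set (DG.E d)} (M : DG.Mesh d Ω) (L : M.Labelling)
    (κ : M.Cell → ℝ) (hκ : ∀ T, 0 < κ T) (α : ℝ) (hα : 0 < α) :
    ∃ b : Module.Basis M.Face ℝ (M.Zbeta L κ),
      (∀ e, (b e : M.VDG) = M.psi L κ e) ∧
      (M.matrixZZ L κ α 0 b).IsDiag ∧
      ∀ e, M.matrixZZ L κ α 0 b e e = α * (M.hE e)⁻¹ * M.area e * M.kappaE L κ e ∧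
        M.matrixZZ L κ α 0 b e e ≠ 0 := by
  have hd0 : 0 < d := by omega
  refine ⟨M.psiBasis L hd0 κ, M.psiBasis_apply L hd0 κ, fun e e' hne => ?_, fun e => ?_⟩
  · change M.A0 L κ α 0 (M.psiBasis L hd0 κ e') (M.psiBasis L hd0 κ e) = 0
    rw [M.psiBasis_apply, M.psiBasis_apply, M.A0_psi L hd0, if_neg hne]
  · have h : M.matrixZZ L κ α 0 (M.psiBasis L hd0 κ) e e =
        α * (M.hE e)⁻¹ * M.area e * M.kappaE L κ e := by
      rw [DG.Mesh.matrixZZ, Matrix.of_apply, M.psiBasis_apply, M.A0_psi L hd0, if_pos rfl]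
    refine ⟨h, ?_⟩
    have h1 := M.area_pos hd0 e
    have h2 : 0 < M.hE e := h1
    have h3 := M.kappaE_pos L hκ e
    rw [h]
    positivity
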